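/- Let $n,m\in\mathbb N$ and let $M_1,\dots,M_m$ be germs at $0$ of real analytic totally real $n$-dimensional submanifolds of $\mathbb C^n$ through $0$. Let $\rho_i(z)=B_i\bar z+R_i(\bar z)$ (with $R_i$ a germ of holomorphic map, $R_i(0)=0$, $DR_i(0)=0$) be the germ of anti-holomorphic involution of $(\mathbb C^n,0)$ whose fixed point set is $M_i$. Let $G$ be the group of germs at $0$ generated by the $F_{i,j}:=\rho_i\circ\rho_j$, $1\le i,j\le m$, whose linear parts at $0$ are $D_{i,j}=B_i\bar B_j$. Assume that $G$ is abelian and that the $D_{i,j}$ are diagonal, $D_{i,j}=\operatorname{diag}(\mu_{i,j,1},\dots,\mu_{i,j,n})$. For $Q\in\mathbb N^n$ write $|Q|=q_1+\dots+q_n$ and $\mu_{i,j}^Q=\prod_l\mu_{i,j,l}^{q_l}$. Assume moreover that (1) (the family $M$ is non-resonant) for all $1\le i\le m$, $1\le k\le n$ and all $Q\in\mathbb N^n$ with $|Q|\ge 2$ there is $1\le j\le m$ with $\bar\mu_{i,j}^{\,Q}\ne\mu_{i,j,k}^{-1}$; (2) ($G$ is formally linearizable) there is a formal diffeomorphism $\hat\Phi$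 of $(\mathbb C^n,0)$, tangent to the identity, such that the coefficient of $x^Q$ in $\hat\Phi_k$ vanishes whenever $|Q|\ge2$ and $\mu_{i,j}^Q=\mu_{i,j,k}$ for all $i,j$, and such that $\hat\Phi\circ g\circ\hat\Phi^{-1}=Dg(0)$ for all $g\in G$; (3) (the family $D=\{D_{i,j}\}$ is diophantine) $-\sum_{k\ge1}2^{-k}\ln\omega_k(D)<+\infty$, where $\omega_k(D)$ is the infimum of the non-zero numbers among $\max_{i,j}|\mu_{i,j}^Q-\mu_{i,j,s}|$ with $Q\in\mathbb N^n$, $2\le|Q|\le2^k$, $1\le s\le n$. Then there is a germ of holomorphic diffeomorphism $\Phi$ of $(\mathbb C^n,0)$, tangent to the identity at $0$, such that for every $i$ the germ $\Phi(M_i)$ is the germ at $0$ of the linear totally real subspace $\{z\in\mathbb C^n : B_i\bar z=z\}$. -/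

import Mathlib

open Filter Topology

namespace TotallyRealFamily

/-- The space `ℂⁿ`. A germ of a map at `0` is represented by any map defining it, and germs are compared
on neighbourhoods of `0`. -/
abbrev V (n : ℕ) : Type := Fin n → ℂ

/-- A (maximal) totally real linear subspace of `ℂⁿ`: a real subspace `L` of real dimension `n`
with `L ∩ iL = 0`. -/
def IsTotallyReal {n : ℕ} (L : Submodule ℝ (V n)) : Prop :=
  Module.finrank ℝ L = n ∧ ∀ z ∈ L, Complex.I • z ∈ L → z = 0

/-- `M` is, near `0`, a real analytic totally real `n`-dimensional submanifold of `ℂⁿ` through `0`: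
it is the zero set of a real analytic submersion `g : (ℂⁿ, 0) → (ℝⁿ, 0)` whose kernel at `0`
(the tangent space of `M` at `0`) is totally real. -/
def IsTotallyRealSubmanifoldGerm {n : ℕ} (M : Set (V n)) : Prop :=
  ∃ g : V n → (Fin n → ℝ), AnalyticAt ℝ g 0 ∧ g 0 = 0 ∧
    Function.Surjective (fderiv ℝ g 0) ∧
    IsTotallyReal (LinearMap.ker (fderiv ℝ g 0 : V n →ₗ[ℝ] (Fin n → ℝ))) ∧
    ∀ᶠ z in 𝓝 (0 : V n), z ∈ M ↔ g z = 0

/-- `ρ` is a germ at `0` of an anti-holomorphic involution, `ρ z = h (conj z)` with `h`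
holomorphic near `0`, fixing `0`, whose fixed point set is `M` near `0`. -/
structure IsInvolutionOf {n : ℕ} (M : Set (V n)) (ρ : V n → V n) : Prop where
  antiholomorphic : AnalyticAt ℂ (fun w => ρ (star w)) 0
  map_zero : ρ 0 = 0
  involutive : ∀ᶠ z in 𝓝 (0 : V n), ρ (ρ z) = z
  fixed : ∀ᶠ z in 𝓝 (0 : V n), z ∈ M ↔ ρ z = z

/-- The matrix `B` of the linear part of an anti-holomorphic germ,
`ρ z = B (conj z) + (terms of order at least 2 in conj z)`. -/
noncomputable def antilinearPart {n : ℕ} (ρ : V n → V n) : Matrix (Fin n) (Fin n) ℂ :=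
  LinearMap.toMatrix' (fderiv ℂ (fun w => ρ (star w)) 0 : V n →ₗ[ℂ] V n)

/-- The matrix of the linear part at `0` of a holomorphic germ. -/
noncomputable def linearPart {n : ℕ} (g : V n → V n) : Matrix (Fin n) (Fin n) ℂ :=
  LinearMap.toMatrix' (fderiv ℂ g 0 : V n →ₗ[ℂ] V n)

/-- The group `G` of germs at `0` generated by the `F_{i,j} = ρ_i ∘ ρ_j`. -/
inductive generatedGroup {n m : ℕ} (ρ : Fin m → V n → V n) : (V n → V n) → Prop
  | gen (i j : Fin m) : generatedGroup ρ (ρ i ∘ ρ j)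
  | one : generatedGroup ρ id
  | comp (f g : V n → V n) : generatedGroup ρ f → generatedGroup ρ g → generatedGroup ρ (f ∘ g)
  | inv (f g : V n → V n) : generatedGroup ρ f → g 0 = 0 → f ∘ g =ᶠ[𝓝 0] id →
      g ∘ f =ᶠ[𝓝 0] id → generatedGroup ρ g

/-- The group `G` is abelian (as a group of germs). -/
def IsCommutative {n m : ℕ} (ρ : Fin m → V n → V n) : Prop :=
  ∀ f g, generatedGroup ρ f → generatedGroup ρ g → f ∘ g =ᶠ[𝓝 0] g ∘ f

/-- `x ^ Q = x_1 ^ {q_1} ⋯ x_n ^ {q_n}`. -/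
noncomputable def monom {n : ℕ} (x : V n) (Q : Fin n →₀ ℕ) : ℂ := ∏ l, x l ^ Q l

/-- The tuple `T` of formal power series is the Taylor expansion of the germ `g` at `0`. -/
def HasTaylorSeries {n : ℕ} (g : V n → V n) (T : Fin n → MvPowerSeries (Fin n) ℂ) : Prop :=
  ∀ᶠ z in 𝓝 (0 : V n), ∀ k, HasSum (fun Q => MvPowerSeries.coeff Q (T k) * monom z Q) (g z k)

/-- The formal vector monomial `x ^ Q e_k`, `|Q| ≥ 2`, commutes with all the diagonal maps
`diag (μ a)`; these monomials span the non-linear formal centralizer of the family. -/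
def IsResonant {n : ℕ} {ι : Type*} (μ : ι → V n) (Q : Fin n →₀ ℕ) (k : Fin n) : Prop :=
  2 ≤ Q.degree ∧ ∀ a, monom (μ a) Q = μ a k

/-- A set `S` of germs is formally linearizable (relative to the family of diagonal linear maps
`diag (μ a)`): there is a formal diffeomorphism `Φ`, tangent to the identity, with zero projection
on the non-linear centralizer of the linear maps, such that `Φ ∘ g = (Dg(0)) ∘ Φ` as formal
power series for all `g ∈ S`. -/
def IsFormallyLinearizable {n : ℕ} {ι : Type*} (S : (V n → V n) → Prop) (μ : ι → V n) : Prop :=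
  ∃ Φ : Fin n → MvPowerSeries (Fin n) ℂ,
    (∀ k, MvPowerSeries.constantCoeff (Φ k) = 0) ∧
    (∀ k l, MvPowerSeries.coeff (Finsupp.single l 1) (Φ k) = if l = k then 1 else 0) ∧
    (∀ Q k, IsResonant μ Q k → MvPowerSeries.coeff Q (Φ k) = 0) ∧
    ∀ g, S g → ∃ T, HasTaylorSeries g T ∧
      ∀ k, (Φ k).subst T = ∑ l, linearPart g k l • Φ l

/-- `max_a |μ_a ^ Q - μ_{a,k}|`. -/
noncomputable def smallDivisor {n : ℕ} {ι : Type*} (μ : ι → V n) (Q : Fin n →₀ ℕ) (k : Fin n) :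
    ℝ :=
  ⨆ a, ‖monom (μ a) Q - μ a k‖

/-- `ω_k(D)`: the smallest non-zero `max_a |μ_a ^ Q - μ_{a,j}|` with `2 ≤ |Q| ≤ 2 ^ k`. -/
noncomputable def omega {n : ℕ} {ι : Type*} (μ : ι → V n) (k : ℕ) : ℝ :=
  sInf {r | r ≠ 0 ∧ ∃ Q j, 2 ≤ Q.degree ∧ Q.degree ≤ 2 ^ k ∧ r = smallDivisor μ Q j}

/-- `- ∑_{k ≥ 1} ln ω_k(D) / 2 ^ k < ∞`. The terms `- ln ω_k(D)` are nondecreasing in `k`, hence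
bounded below, so this is summability. (If no divisor is non-zero, the infimum is over the empty
set and the condition holds, as it should.) -/
def IsDiophantine {n : ℕ} {ι : Type*} (μ : ι → V n) : Prop :=
  Summable fun k : ℕ => -Real.log (omega μ (k + 1)) / 2 ^ (k + 1)

/-- For all `i`, `k` and `|Q| ≥ 2` there is `j` with `conj(μ_{i,j}) ^ Q ≠ μ_{i,j,k}⁻¹`. -/
def IsNonResonant {n m : ℕ} (μ : Fin m → Fin m → V n) : Prop :=
  ∀ i k, ∀ Q : Fin n →₀ ℕ, 2 ≤ Q.degree → ∃ j, monom (star (μ i j)) Q ≠ (μ i j k)⁻¹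

/-- The real linear subspace `{z | B (conj z) = z}`. -/
def fixedSubspace {n : ℕ} (B : Matrix (Fin n) (Fin n) ℂ) : Submodule ℝ (V n) where
  carrier := {z | B.mulVec (star z) = z}
  add_mem' := by
    intro a b ha hb
    simp only [Set.mem_ofPred_eq] at ha hb ⊢
    rw [star_add, Matrix.mulVec_add, ha, hb]
  zero_mem' := by simp
  smul_mem' := by
    intro c a ha
    simp only [Set.mem_ofPred_eq] at ha ⊢
    rw [star_smul, star_trivial, Matrix.mulVec_smul, ha]

end TotallyRealFamily

open TotallyRealFamily

open scoped ENNReal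

/-! The plan is to linearize all the `ρ i ∘ ρ j` by one convergent change of coordinates, and then
to see that the same change linearizes each `ρ i`. Once `Φ ∘ ρ i ∘ Φ⁻¹` is `z ↦ B i (conj z)`, its
fixed points form a linear subspace, and `Φ` carries `M i` onto it.

Since `ρ i` is an involution, `B i * conj (B i) = 1`, so `D_{j,i} = D_{i,j}⁻¹` and `B i` intertwines
`conj D_{i,j}` with `D_{j,i}`. Through this relation, non-resonance of the family of submanifolds
forces `μ ^ Q ≠ μ_k` for some generator, whatever `Q` of degree at least two and `k`
(`IsNonResonant.hasNoResonance`). Hence no divisor `smallDivisor μ Q k` vanishes.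

Let `A` be the formal linearization and `g` its formal inverse. Then `T ∘ g = g ∘ diag(μ)` for the
Taylor series `T` of each generator. Comparing coefficients, and choosing for every `Q` and `k` the
generator with the largest divisor, bounds the divisor times a coefficient of `g` by coefficients of
a nonlinear composition (`smallDivisor_mul_coeff_le`). The divisors are absorbed by a weight `w`
that decays at most geometrically (`exists_weight`). This is Brjuno's count of small divisors, put
in the form of a subadditive potential (`indicator_add_sum_potential_le`). The weighted series then
obeys a majorant equation without small divisors and converges (`diagEval_le_of_majorant`).

Let `Ψ` be the sum of `g` and `Φ` its local inverse. The germ `Φ ∘ ρ i ∘ Ψ ∘ conj` is holomorphic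
and intertwines `conj D_{i,j}` with `D_{i,j}⁻¹` for all `j`. Non-resonance kills its nonlinear
Taylor terms, so it equals its linear part `B i` (`eventually_conj_eq_mulVec`). -/

namespace TotallyRealFamily

/-! ### Coefficients of products of series without constant term -/

section FormalSeries

variable {σ S : Type*}

/-- With at least two factors, a term in which one factor takes the full degree leaves degree zero
to another factor, whose constant term vanishes. Only strictly lower degrees contribute, which is
what makes the recursions below well founded. -/
theorem coeff_prod_congr_of_lt [CommSemiring S] {ι : Type*} [Fintype ι] [Nontrivial ι]
    {a b : ι → MvPowerSeries σ S} (ha : ∀ i, MvPowerSeries.constantCoeff (a i) = 0)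
    (hb : ∀ i, MvPowerSeries.constantCoeff (b i) = 0) {Q : σ →₀ ℕ}
    (hab : ∀ i (P : σ →₀ ℕ), P.degree < Q.degree →
      MvPowerSeries.coeff P (a i) = MvPowerSeries.coeff P (b i)) :
    MvPowerSeries.coeff Q (∏ i, a i) = MvPowerSeries.coeff Q (∏ i, b i) := by
  classical
  rw [MvPowerSeries.coeff_prod, MvPowerSeries.coeff_prod]
  refine Finset.sum_congr rfl fun q hq => ?_
  rw [Finset.mem_finsuppAntidiag] at hq
  have hdeg : ∑ i, (q i).degree = Q.degree := by rw [← hq.1, map_sum]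
  by_cases h : ∀ i, (q i).degree < Q.degree
  · exact Finset.prod_congr rfl fun i _ => hab i _ (h i)
  · push Not at h
    obtain ⟨i, hi⟩ := h
    obtain ⟨j, hj⟩ := exists_ne i
    have hle : (q i).degree + (q j).degree ≤ Q.degree := by
      rw [← hdeg, ← Finset.sum_pair (f := fun i => (q i).degree) hj.symm]
      exact Finset.sum_le_sum_of_subset (Finset.subset_univ _)
    have hzero : q j = 0 := by
      rw [← Finsupp.degree_eq_zero_iff]
      omega
    rw [Finset.prod_eq_zero (Finset.mem_univ j), Finset.prod_eq_zero (Finset.mem_univ j)]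
    · rw [hzero, MvPowerSeries.coeff_zero_eq_constantCoeff_apply, hb]
    · rw [hzero, MvPowerSeries.coeff_zero_eq_constantCoeff_apply, ha]

/-- The factors of the monomial `x ^ R`, counted with multiplicity. -/
abbrev Factors {n : ℕ} (R : Fin n →₀ ℕ) : Type := Σ l : Fin n, Fin (R l)

theorem card_factors {n : ℕ} (R : Fin n →₀ ℕ) : Fintype.card (Factors R) = R.degree := by
  simp [Finsupp.degree_eq_sum]

theorem nontrivial_factors {n : ℕ} {R : Fin n →₀ ℕ} (hR : 2 ≤ R.degree) :
    Nontrivial (Factors R) := by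
  rw [← Fintype.one_lt_card_iff_nontrivial, card_factors]
  omega

theorem prod_pow_eq_prod_factors {n : ℕ} [CommMonoid S] (a : Fin n → S) (R : Fin n →₀ ℕ) :
    ∏ l, a l ^ R l = ∏ i : Factors R, a i.1 := by
  rw [Fintype.prod_sigma]
  simp

theorem finsuppProd_pow_eq_prod_factors {n : ℕ} [CommMonoid S] (a : Fin n → S) (R : Fin n →₀ ℕ) :
    (R.prod fun l e => a l ^ e) = ∏ i : Factors R, a i.1 := by
  rw [← prod_pow_eq_prod_factors, Finsupp.prod_fintype _ _ (by simp)]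

end FormalSeries

/-! ### Formal inversion of series tangent to the identity -/

section FormalInverse

variable {n : ℕ}

/-- The tuple `A` of formal power series has no constant terms and identity linear part. -/
structure IsTangentToId (A : Fin n → MvPowerSeries (Fin n) ℂ) : Prop where
  constantCoeff_eq_zero : ∀ k, MvPowerSeries.constantCoeff (A k) = 0
  coeff_single : ∀ k l, MvPowerSeries.coeff (Finsupp.single l 1) (A k) = if l = k then 1 else 0

theorem coeff_subst_congr_of_lt {a b : Fin n → MvPowerSeries (Fin n) ℂ}
    (ha : ∀ i, MvPowerSeries.constantCoeff (a i) = 0)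
    (hb : ∀ i, MvPowerSeries.constantCoeff (b i) = 0) {Q : Fin n →₀ ℕ}
    (hab : ∀ i (P : Fin n →₀ ℕ), P.degree < Q.degree →
      MvPowerSeries.coeff P (a i) = MvPowerSeries.coeff P (b i))
    {f : MvPowerSeries (Fin n) ℂ}
    (hf : ∀ R : Fin n →₀ ℕ, R.degree < 2 → MvPowerSeries.coeff R f = 0) :
    MvPowerSeries.coeff Q (f.subst a) = MvPowerSeries.coeff Q (f.subst b) := by
  rw [MvPowerSeries.coeff_subst (MvPowerSeries.hasSubst_of_constantCoeff_zero ha),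
    MvPowerSeries.coeff_subst (MvPowerSeries.hasSubst_of_constantCoeff_zero hb)]
  refine finsum_congr fun R => ?_
  by_cases hR : R.degree < 2
  · simp [hf R hR]
  · have := nontrivial_factors (not_lt.mp hR)
    rw [finsuppProd_pow_eq_prod_factors, finsuppProd_pow_eq_prod_factors,
      coeff_prod_congr_of_lt (a := fun i : Factors R => a i.1) (b := fun i => b i.1)
        (fun i => ha i.1) (fun i => hb i.1) fun i => hab i.1]

theorem degree_lt_two_cases {Q : Fin n →₀ ℕ} (hQ : Q.degree < 2) :
    Q = 0 ∨ ∃ l, Q = Finsupp.single l 1 := by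
  rcases Nat.lt_or_ge Q.degree 1 with h | h
  · left
    rw [← Finsupp.degree_eq_zero_iff]
    omega
  · right
    have hQ0 : Q ≠ 0 := by
      rintro rfl
      simp at h
    obtain ⟨l, hl⟩ := Finsupp.ne_iff.mp hQ0
    rw [Finsupp.zero_apply] at hl
    have hle : Finsupp.single l 1 ≤ Q := by
      rw [Finsupp.single_le_iff]
      omega
    obtain ⟨P, rfl⟩ := exists_add_of_le hle
    rw [map_add, Finsupp.degree_single] at hQ
    have hP : P = 0 := by
      rw [← Finsupp.degree_eq_zero_iff]
      omega
    exact ⟨l, by rw [hP, add_zero]⟩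

theorem IsTangentToId.coeff_sub_X {A : Fin n → MvPowerSeries (Fin n) ℂ} (hA : IsTangentToId A)
    (k : Fin n) {R : Fin n →₀ ℕ} (hR : R.degree < 2) :
    MvPowerSeries.coeff R (A k - MvPowerSeries.X k) = 0 := by
  classical
  rcases degree_lt_two_cases hR with rfl | ⟨l, rfl⟩
  · simp [hA.constantCoeff_eq_zero]
  · simp [hA.coeff_single, MvPowerSeries.coeff_X, Finsupp.single_left_inj]

theorem coeff_subst_eq_zero_of_degree_lt_two {a : Fin n → MvPowerSeries (Fin n) ℂ}
    (ha : ∀ i, MvPowerSeries.constantCoeff (a i) = 0) {f : MvPowerSeries (Fin n) ℂ}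
    (hf : ∀ R : Fin n →₀ ℕ, R.degree < 2 → MvPowerSeries.coeff R f = 0)
    {Q : Fin n →₀ ℕ} (hQ : Q.degree < 2) : MvPowerSeries.coeff Q (f.subst a) = 0 := by
  rw [coeff_subst_congr_of_lt ha (b := fun _ => 0) (by simp) (fun i P hP => ?_) hf]
  · have h0 : MvPowerSeries.constantCoeff f = 0 := by
      simpa using hf 0 (by simp)
    have := MvPowerSeries.subst_zero_of_constantCoeff_zero (τ := Fin n) (S := ℂ) h0
    have h2 : (fun _ => 0 : Fin n → MvPowerSeries (Fin n) ℂ) = 0 := rfl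
    rw [h2, this]
    simp
  · have hP0 : P = 0 := by
      rw [← Finsupp.degree_eq_zero_iff]
      omega
    simp [hP0, ha]

/-- The iteration `A ↦ X - φ(A)` solving `A + φ(A) = X`. -/
noncomputable def inverseIterate (φ : Fin n → MvPowerSeries (Fin n) ℂ) :
    ℕ → Fin n → MvPowerSeries (Fin n) ℂ
  | 0 => MvPowerSeries.X
  | N + 1 => fun k => MvPowerSeries.X k - (φ k).subst (inverseIterate φ N)

/-- The iteration is a contraction for the degree filtration: each step fixes the coefficients of
one more degree, because `φ` starts in degree two. The inverse reads off the coefficient of `Q` at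
step `Q.degree`, where it is already stable. -/
theorem IsTangentToId.exists_rightInverse {A : Fin n → MvPowerSeries (Fin n) ℂ}
    (hA : IsTangentToId A) :
    ∃ B, IsTangentToId B ∧ ∀ k, (A k).subst B = MvPowerSeries.X k := by
  classical
  let φ : Fin n → MvPowerSeries (Fin n) ℂ := fun k => A k - MvPowerSeries.X k
  have hφ : ∀ k (R : Fin n →₀ ℕ), R.degree < 2 → MvPowerSeries.coeff R (φ k) = 0 :=
    fun k R hR => hA.coeff_sub_X k hR
  let I := inverseIterate φ
  have hI0 : ∀ N k, MvPowerSeries.constantCoeff (I N k) = 0 := by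
    intro N
    induction N with
    | zero => intro k; exact MvPowerSeries.constantCoeff_X k
    | succ N ih =>
      intro k
      have h := coeff_subst_eq_zero_of_degree_lt_two ih (hφ k) (Q := 0) (by simp)
      rw [MvPowerSeries.coeff_zero_eq_constantCoeff_apply] at h
      change MvPowerSeries.constantCoeff (MvPowerSeries.X k - (φ k).subst (I N)) = 0
      rw [map_sub, MvPowerSeries.constantCoeff_X, h, sub_zero]
  have hstep : ∀ N k (Q : Fin n →₀ ℕ), Q.degree ≤ N →
      MvPowerSeries.coeff Q (I (N + 1) k) = MvPowerSeries.coeff Q (I N k) := by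
    intro N
    induction N with
    | zero =>
      intro k Q hQ
      have hQ0 : Q = 0 := by
        rw [← Finsupp.degree_eq_zero_iff]
        omega
      rw [hQ0, MvPowerSeries.coeff_zero_eq_constantCoeff_apply,
        MvPowerSeries.coeff_zero_eq_constantCoeff_apply, hI0, hI0]
    | succ N ih =>
      intro k Q hQ
      change MvPowerSeries.coeff Q (MvPowerSeries.X k - (φ k).subst (I (N + 1))) =
        MvPowerSeries.coeff Q (MvPowerSeries.X k - (φ k).subst (I N))
      rw [map_sub, map_sub, coeff_subst_congr_of_lt (hI0 _) (hI0 _)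
        (fun i P hP => ih i P (by omega)) (hφ k)]
  have hstable : ∀ N M k (Q : Fin n →₀ ℕ), N ≤ M → Q.degree ≤ N →
      MvPowerSeries.coeff Q (I M k) = MvPowerSeries.coeff Q (I N k) := by
    intro N M k Q hNM hQ
    induction M, hNM using Nat.le_induction with
    | base => rfl
    | succ M hM ih => rw [hstep M k Q (hQ.trans hM), ih]
  let B : Fin n → MvPowerSeries (Fin n) ℂ := fun k Q => MvPowerSeries.coeff Q (I Q.degree k)
  have hB : ∀ N k (Q : Fin n →₀ ℕ), Q.degree ≤ N →
      MvPowerSeries.coeff Q (B k) = MvPowerSeries.coeff Q (I N k) := by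
    intro N k Q hQ
    exact (hstable _ _ k Q hQ le_rfl).symm
  have hB0 : ∀ k, MvPowerSeries.constantCoeff (B k) = 0 := by
    intro k
    rw [← MvPowerSeries.coeff_zero_eq_constantCoeff_apply, hB 0 k 0 (by simp),
      MvPowerSeries.coeff_zero_eq_constantCoeff_apply, hI0]
  refine ⟨B, ⟨hB0, fun k l => ?_⟩, fun k => ?_⟩
  · have h := coeff_subst_eq_zero_of_degree_lt_two (hI0 0) (hφ k) (Q := Finsupp.single l 1)
      (by simp)
    rw [hB 1 k _ (by simp)]
    change MvPowerSeries.coeff _ (MvPowerSeries.X k - (φ k).subst (I 0)) = _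
    rw [map_sub, h, MvPowerSeries.coeff_X]
    simp [Finsupp.single_left_inj]
  · have hs := MvPowerSeries.hasSubst_of_constantCoeff_zero hB0
    have hsplit : A k = MvPowerSeries.X k + φ k := by simp [φ]
    ext Q
    rw [hsplit, MvPowerSeries.subst_add hs, MvPowerSeries.subst_X hs, map_add,
      hB (Q.degree + 1) k Q (by omega)]
    change MvPowerSeries.coeff Q (MvPowerSeries.X k - (φ k).subst (I Q.degree)) + _ = _
    rw [map_sub, coeff_subst_congr_of_lt (hI0 _) hB0
      (fun i P hP => (hB Q.degree i P hP.le).symm) (hφ k), sub_add_cancel]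

/-- As in a monoid: a right inverse `B` has itself a right inverse `C`, and associativity of
substitution gives `A = C`. -/
theorem IsTangentToId.exists_inverse {A : Fin n → MvPowerSeries (Fin n) ℂ}
    (hA : IsTangentToId A) :
    ∃ B, IsTangentToId B ∧ (∀ k, (A k).subst B = MvPowerSeries.X k) ∧
      ∀ k, (B k).subst A = MvPowerSeries.X k := by
  obtain ⟨B, hB, hAB⟩ := hA.exists_rightInverse
  obtain ⟨C, hC, hBC⟩ := hB.exists_rightInverse
  have hsB := MvPowerSeries.hasSubst_of_constantCoeff_zero hB.constantCoeff_eq_zero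
  have hsC := MvPowerSeries.hasSubst_of_constantCoeff_zero hC.constantCoeff_eq_zero
  have hAC : A = C := by
    funext k
    have h := MvPowerSeries.subst_comp_subst_apply hsB hsC (A k)
    rw [hAB, MvPowerSeries.subst_X hsC] at h
    simp only [hBC] at h
    rw [h]
    exact (congrFun MvPowerSeries.subst_self (A k)).symm
  exact ⟨B, hB, hAB, hAC ▸ hBC⟩

/-- If `A ∘ T = diag(ν) ∘ A` and `B` is the formal inverse of `A`, then `T ∘ B = B ∘ diag(ν)`. -/
theorem subst_inverse_eq_rescale {A B T : Fin n → MvPowerSeries (Fin n) ℂ} {ν : V n}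
    (hA : IsTangentToId A) (hB : IsTangentToId B) (hAB : ∀ k, (A k).subst B = MvPowerSeries.X k)
    (hBA : ∀ k, (B k).subst A = MvPowerSeries.X k)
    (hT : ∀ k, MvPowerSeries.constantCoeff (T k) = 0)
    (hAT : ∀ k, (A k).subst T = ν k • A k) (k : Fin n) :
    (T k).subst B = MvPowerSeries.rescale ν (B k) := by
  have hsA := MvPowerSeries.hasSubst_of_constantCoeff_zero hA.constantCoeff_eq_zero
  have hsB := MvPowerSeries.hasSubst_of_constantCoeff_zero hB.constantCoeff_eq_zero
  have hsT := MvPowerSeries.hasSubst_of_constantCoeff_zero hT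
  have h1 : T k = (B k).subst fun l => ν l • A l := by
    have h := MvPowerSeries.subst_comp_subst_apply hsA hsT (B k)
    rw [hBA, MvPowerSeries.subst_X hsT] at h
    rw [h]
    simp only [hAT]
  have hsνA : MvPowerSeries.HasSubst fun l => ν l • A l :=
    MvPowerSeries.hasSubst_of_constantCoeff_zero fun l => by simp [hA.constantCoeff_eq_zero]
  rw [h1, MvPowerSeries.subst_comp_subst_apply hsνA hsB, MvPowerSeries.rescale_eq_subst]
  congr 1
  funext l
  rw [MvPowerSeries.subst_smul hsB, hAB]
  rfl

/-- The linear part of `T` is read off from `A ∘ T = L ∘ A`. -/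
theorem coeff_single_of_subst_eq {A T : Fin n → MvPowerSeries (Fin n) ℂ}
    {L : Matrix (Fin n) (Fin n) ℂ} (hA : IsTangentToId A)
    (hT : ∀ k, MvPowerSeries.constantCoeff (T k) = 0)
    (hAT : ∀ k, (A k).subst T = ∑ l, L k l • A l) (k l : Fin n) :
    MvPowerSeries.coeff (Finsupp.single l 1) (T k) = L k l := by
  classical
  have hsT := MvPowerSeries.hasSubst_of_constantCoeff_zero hT
  have h := congrArg (MvPowerSeries.coeff (Finsupp.single l 1)) (hAT k)
  have hsplit : A k = MvPowerSeries.X k + (A k - MvPowerSeries.X k) := by simp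
  rw [hsplit, MvPowerSeries.subst_add hsT, MvPowerSeries.subst_X hsT, map_add,
    coeff_subst_eq_zero_of_degree_lt_two hT (fun R => hA.coeff_sub_X k) (by simp), add_zero] at h
  rw [h, map_sum]
  simp [hA.coeff_single]

end FormalInverse

/-! ### Brjuno's counting of small divisors as a subadditive potential -/

section Potential

/-- Brjuno's bound for the number of small divisors of scale `m` in a tree of degree `d`. -/
noncomputable def profile (m : ℝ) (d : ℕ) : ℝ := max 0 (2 * d / m - 1)

theorem profile_nonneg (m : ℝ) (d : ℕ) : 0 ≤ profile m d := le_max_left _ _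

theorem profile_le {m : ℝ} (hm : 0 < m) (d : ℕ) : profile m d ≤ 2 * d / m :=
  max_le (by positivity) (by linarith)

theorem profile_mono {m : ℝ} (hm : 0 < m) {d e : ℕ} (h : d ≤ e) : profile m d ≤ profile m e := by
  unfold profile
  gcongr

theorem profile_eq_of_pos {m : ℝ} {d : ℕ} (h : 0 < profile m d) :
    profile m d = 2 * d / m - 1 := by
  unfold profile at *
  rcases lt_max_iff.mp h with h | h
  · exact absurd h (lt_irrefl _)
  · exact max_eq_right h.le

/-- Every positive term carries its own `-1`, so two of them already gain `2` on the linear bound.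
Otherwise the sum reduces to at most one term. -/
theorem sum_profile_cases {J : Type*} [Fintype J] {m : ℝ} (hm : 0 < m) {f : J → ℝ} {d : J → ℕ}
    {D : ℕ} (hf : ∀ i, 0 ≤ f i) (hfd : ∀ i, f i ≤ profile m (d i)) (hd : ∑ i, d i ≤ D) :
    ∑ i, f i ≤ 2 * D / m - 2 ∨ (∃ i, ∑ i, f i = f i) ∨ ∑ i, f i = 0 := by
  classical
  by_cases h2 : ∃ i j, i ≠ j ∧ 0 < f i ∧ 0 < f j
  · left
    obtain ⟨i, j, hij, hi, hj⟩ := h2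
    have hle : ∀ l, f l ≤ 2 * d l / m - ((if l = i then 1 else 0) + if l = j then 1 else 0) := by
      intro l
      by_cases hli : l = i
      · subst hli
        have h := profile_eq_of_pos (hi.trans_le (hfd l))
        simp only [if_true, if_neg hij]
        linarith [hfd l]
      · by_cases hlj : l = j
        · subst hlj
          have h := profile_eq_of_pos (hj.trans_le (hfd l))
          simp only [if_true, if_neg hli]
          linarith [hfd l]
        · simp only [if_neg hli, if_neg hlj]
          linarith [hfd l, profile_le hm (d l)]
    have hD : (∑ l, (d l : ℝ)) ≤ D := by exact_mod_cast hd
    calc ∑ l, f l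
        ≤ ∑ l, (2 * d l / m - ((if l = i then (1 : ℝ) else 0) + if l = j then 1 else 0)) :=
          Finset.sum_le_sum fun l _ => hle l
      _ = 2 * (∑ l, (d l : ℝ)) / m - 2 := by
          rw [Finset.sum_sub_distrib, Finset.sum_add_distrib, Finset.mul_sum, Finset.sum_div]
          simp
          norm_num
      _ ≤ 2 * D / m - 2 := by gcongr
  · right
    push Not at h2
    by_cases h1 : ∃ i, 0 < f i
    · left
      obtain ⟨i, hi⟩ := h1
      exact ⟨i, Finset.sum_eq_single i (fun j _ hj => le_antisymm (h2 i j hj.symm hi) (hf j))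
        fun h => absurd (Finset.mem_univ i) h⟩
    · right
      push Not at h1
      exact Finset.sum_eq_zero fun i _ => le_antisymm (h1 i) (hf i)

theorem sum_le_profile_sub_one {J : Type*} [Fintype J] {m : ℝ} (hm : 0 < m) {f : J → ℝ}
    {d : J → ℕ} {D : ℕ} (hf : ∀ i, 0 ≤ f i) (hfd : ∀ i, f i ≤ profile m (d i))
    (hd : ∑ i, d i ≤ D) (hD : m ≤ D) (h : ∀ i, f i ≤ profile m D - 1) :
    ∑ i, f i ≤ profile m D - 1 := by
  have hp : 2 * D / m - 1 ≤ profile m D := le_max_right _ _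
  have h1 : 1 ≤ D / m := (one_le_div hm).mpr hD
  have h2 : (2 : ℝ) * D / m = 2 * (D / m) := by ring
  rcases sum_profile_cases hm hf hfd hd with h' | ⟨i, h'⟩ | h'
  · linarith
  · rw [h']
    exact h i
  · rw [h']
    linarith

theorem sum_le_profile {J : Type*} [Fintype J] {m : ℝ} (hm : 0 < m) {f : J → ℝ}
    {d : J → ℕ} {D : ℕ} (hf : ∀ i, 0 ≤ f i) (hfd : ∀ i, f i ≤ profile m (d i))
    (hd : ∑ i, d i ≤ D) : ∑ i, f i ≤ profile m D := by
  have hp : 2 * D / m - 1 ≤ profile m D := le_max_right _ _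
  rcases sum_profile_cases hm hf hfd hd with h' | ⟨i, h'⟩ | h'
  · linarith
  · rw [h']
    refine (hfd i).trans (profile_mono hm (le_trans ?_ hd))
    exact Finset.single_le_sum (f := d) (fun _ _ => Nat.zero_le _) (Finset.mem_univ i)
  · rw [h']
    exact profile_nonneg _ _

variable {σ : Type*}

/-- A subadditive bound for the number of elements of `C` in a tree with root `Q`. -/
noncomputable def potential (m : ℝ) (C : Set (σ →₀ ℕ)) (Q : σ →₀ ℕ) : ℝ :=
  sInf (insert (profile m Q.degree) {y | ∃ R ∈ C, Q < R ∧ y = profile m R.degree - 1})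

variable {m : ℝ} {C : Set (σ →₀ ℕ)}

theorem le_potential {Q : σ →₀ ℕ} {x : ℝ} (h : x ≤ profile m Q.degree)
    (h' : ∀ R ∈ C, Q < R → x ≤ profile m R.degree - 1) : x ≤ potential m C Q := by
  refine le_csInf (Set.insert_nonempty _ _) ?_
  rintro y (rfl | ⟨R, hR, hQR, rfl⟩)
  · exact h
  · exact h' R hR hQR

theorem one_le_profile (hm : 0 < m) {d : ℕ} (hd : m ≤ d) : 1 ≤ profile m d := by
  have h1 : 1 ≤ d / m := (one_le_div hm).mpr hd
  have h2 : (2 : ℝ) * d / m = 2 * (d / m) := by ring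
  exact le_max_of_le_right (by linarith)

theorem potential_bddBelow (hm : 0 < m) (hC : ∀ R ∈ C, m ≤ R.degree) (Q : σ →₀ ℕ) :
    BddBelow (insert (profile m Q.degree)
      {y | ∃ R ∈ C, Q < R ∧ y = profile m R.degree - 1}) := by
  refine ⟨0, ?_⟩
  rintro y (rfl | ⟨R, hR, -, rfl⟩)
  · exact profile_nonneg _ _
  · linarith [one_le_profile hm (hC R hR)]

theorem potential_nonneg (hm : 0 < m) (hC : ∀ R ∈ C, m ≤ R.degree) (Q : σ →₀ ℕ) :
    0 ≤ potential m C Q :=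
  le_potential (profile_nonneg _ _) fun R hR _ => by linarith [one_le_profile hm (hC R hR)]

theorem potential_le_profile (hm : 0 < m) (hC : ∀ R ∈ C, m ≤ R.degree) (Q : σ →₀ ℕ) :
    potential m C Q ≤ profile m Q.degree :=
  csInf_le (potential_bddBelow hm hC Q) (Set.mem_insert _ _)

theorem potential_le_sub_one (hm : 0 < m) (hC : ∀ R ∈ C, m ≤ R.degree) {Q R : σ →₀ ℕ}
    (hR : R ∈ C) (hQR : Q < R) : potential m C Q ≤ profile m R.degree - 1 :=
  csInf_le (potential_bddBelow hm hC Q) (Set.mem_insert_of_mem _ ⟨R, hR, hQR, rfl⟩)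

theorem degree_mono {Q R : σ →₀ ℕ} (h : Q ≤ R) : Q.degree ≤ R.degree := by
  obtain ⟨P, rfl⟩ := exists_add_of_le h
  simp

/-- The inductive step of Brjuno's count. If `R ∈ C` lies above or at `Q`, every child is strictly
below `R`, so each child, and by `sum_le_profile_sub_one` also their sum, stays below the profile of
`R` by one. This spare unit pays for `Q` itself when `Q ∈ C`. Against a larger `R ∈ C` the gap makes
the profile grow by at least two, enough to pay for both units. -/
theorem indicator_add_sum_potential_le (hm : 0 < m) (hC : ∀ R ∈ C, m ≤ R.degree)
    (hgap : ∀ Q ∈ C, ∀ R ∈ C, Q < R → Q.degree + m ≤ R.degree) {J : Type*} [Fintype J]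
    {q : J → σ →₀ ℕ} {Q : σ →₀ ℕ} (hq : ∀ i, q i < Q) (hQ : ∑ i, q i = Q) :
    C.indicator 1 Q + ∑ i, potential m C (q i) ≤ potential m C Q := by
  have hd : ∑ i, (q i).degree = Q.degree := by rw [← hQ, map_sum]
  have h0 : ∀ i, 0 ≤ potential m C (q i) := fun i => potential_nonneg hm hC _
  have h1 : ∀ i, potential m C (q i) ≤ profile m (q i).degree :=
    fun i => potential_le_profile hm hC _
  have hup : ∀ R ∈ C, Q ≤ R → ∑ i, potential m C (q i) ≤ profile m R.degree - 1 :=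
    fun R hR hQR => sum_le_profile_sub_one hm h0 h1 (hd.le.trans (degree_mono hQR)) (hC R hR)
      fun i => potential_le_sub_one hm hC hR ((hq i).trans_le hQR)
  by_cases hQC : Q ∈ C
  · rw [Set.indicator_of_mem hQC, Pi.one_apply]
    refine le_potential (by linarith [hup Q hQC le_rfl]) fun R hR hQR => ?_
    have hpQ := profile_eq_of_pos (lt_of_lt_of_le one_pos (one_le_profile hm (hC Q hQC)))
    have hpR := profile_eq_of_pos (lt_of_lt_of_le one_pos (one_le_profile hm (hC R hR)))
    have h2 : ((Q.degree : ℝ) + m) / m ≤ R.degree / m := by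
      gcongr
      exact hgap Q hQC R hR hQR
    rw [add_div, div_self hm.ne'] at h2
    have h3 : (2 : ℝ) * Q.degree / m = 2 * (Q.degree / m) := by ring
    have h4 : (2 : ℝ) * R.degree / m = 2 * (R.degree / m) := by ring
    linarith [hup Q hQC le_rfl]
  · rw [Set.indicator_of_notMem hQC, zero_add]
    exact le_potential (sum_le_profile hm h0 h1 hd.le) fun R hR hQR => hup R hR hQR.le

end Potential

/-! ### Small divisors and the gap between small exponents -/

section SmallDivisors

variable {n : ℕ} {ι : Type*}

theorem monom_add (x : V n) (P Q : Fin n →₀ ℕ) : monom x (P + Q) = monom x P * monom x Q := by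
  simp [monom, pow_add, Finset.prod_mul_distrib]

theorem monom_single (x : V n) (l : Fin n) : monom x (Finsupp.single l 1) = x l := by
  classical
  unfold monom
  rw [Finset.prod_eq_single l]
  · simp
  · intro b _ hb
    simp [Finsupp.single_eq_of_ne hb]
  · simp

variable [Finite ι] {μ : ι → V n}

theorem le_smallDivisor (a : ι) (Q : Fin n →₀ ℕ) (k : Fin n) :
    ‖monom (μ a) Q - μ a k‖ ≤ smallDivisor μ Q k :=
  le_ciSup (f := fun a => ‖monom (μ a) Q - μ a k‖) (Set.finite_range _).bddAbove a

/-- The family has no resonances. -/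
def HasNoResonance {n : ℕ} {ι : Type*} (μ : ι → V n) : Prop :=
  ∀ (Q : Fin n →₀ ℕ) (k : Fin n), 2 ≤ Q.degree → ∃ a, monom (μ a) Q ≠ μ a k

theorem HasNoResonance.smallDivisor_pos (h : HasNoResonance μ) {Q : Fin n →₀ ℕ}
    (hQ : 2 ≤ Q.degree) (k : Fin n) : 0 < smallDivisor μ Q k := by
  obtain ⟨a, ha⟩ := h Q k hQ
  exact (norm_pos_iff.mpr (sub_ne_zero.mpr ha)).trans_le (le_smallDivisor a Q k)

theorem HasNoResonance.omega_le (h : HasNoResonance μ) {Q : Fin n →₀ ℕ} {v : ℕ}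
    (hQ : 2 ≤ Q.degree) (hQv : Q.degree ≤ 2 ^ v) (k : Fin n) :
    omega μ v ≤ smallDivisor μ Q k := by
  refine csInf_le ⟨0, ?_⟩ ⟨(h.smallDivisor_pos hQ k).ne', Q, k, hQ, hQv, rfl⟩
  rintro r ⟨-, P, j, hP, -, rfl⟩
  exact (h.smallDivisor_pos hP j).le

theorem exists_smallDivisor_eq [Nonempty ι] (μ : ι → V n) (Q : Fin n →₀ ℕ) (k : Fin n) :
    ∃ a, ‖monom (μ a) Q - μ a k‖ = smallDivisor μ Q k :=
  exists_eq_ciSup_of_finite (f := fun a => ‖monom (μ a) Q - μ a k‖)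

/-- The infimum runs over a finite set, so it is attained and positive. The index `v + 1` matters:
`2 ^ 0 = 1` admits no exponent of degree two. -/
theorem omega_mem [Nonempty (Fin n)] (h : HasNoResonance μ) (v : ℕ) :
    ∃ Q j, 2 ≤ Q.degree ∧ Q.degree ≤ 2 ^ (v + 1) ∧ omega μ (v + 1) = smallDivisor μ Q j := by
  have hfin : {r : ℝ | r ≠ 0 ∧ ∃ Q j, 2 ≤ Q.degree ∧ Q.degree ≤ 2 ^ (v + 1) ∧
      r = smallDivisor μ Q j}.Finite := by
    refine ((Finsupp.finite_of_degree_le (σ := Fin n) (2 ^ (v + 1))).prod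
      (Set.finite_univ (α := Fin n)) |>.image fun p => smallDivisor μ p.1 p.2).subset ?_
    rintro r ⟨-, Q, j, -, hQ, rfl⟩
    exact ⟨(Q, j), ⟨hQ, Set.mem_univ _⟩, rfl⟩
  have hne : {r : ℝ | r ≠ 0 ∧ ∃ Q j, 2 ≤ Q.degree ∧ Q.degree ≤ 2 ^ (v + 1) ∧
      r = smallDivisor μ Q j}.Nonempty := by
    obtain ⟨l⟩ := ‹Nonempty (Fin n)›
    have hQ : 2 ≤ (Finsupp.single l 2).degree := by simp
    refine ⟨_, (h.smallDivisor_pos hQ l).ne', _, l, hQ, ?_, rfl⟩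
    rw [Finsupp.degree_single, pow_succ]
    exact Nat.le_mul_of_pos_left 2 (by positivity)
  exact (hne.csInf_mem hfin).2

theorem omega_pos [Nonempty (Fin n)] (h : HasNoResonance μ) (v : ℕ) : 0 < omega μ (v + 1) := by
  obtain ⟨Q, j, hQ, -, hω⟩ := omega_mem h v
  exact hω ▸ h.smallDivisor_pos hQ j

theorem omega_antitone [Nonempty (Fin n)] (h : HasNoResonance μ) (v : ℕ) :
    omega μ (v + 2) ≤ omega μ (v + 1) := by
  obtain ⟨Q, j, hQ, hQv, hω⟩ := omega_mem h v
  rw [hω]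
  exact h.omega_le hQ (hQv.trans (Nat.pow_le_pow_right two_pos (Nat.le_succ _))) j

/-- The exponents whose small divisor in the direction `j` is less than `c`. -/
def smallExponents (μ : ι → V n) (c : ℝ) (j : Fin n) : Set (Fin n →₀ ℕ) :=
  {R | 2 ≤ R.degree ∧ smallDivisor μ R j < c}

theorem lt_degree_of_mem_smallExponents (h : HasNoResonance μ) {v : ℕ} {c : ℝ} {j : Fin n}
    (hc : c ≤ omega μ v) {R : Fin n →₀ ℕ} (hR : R ∈ smallExponents μ c j) : 2 ^ v < R.degree := by
  by_contra! hle
  linarith [h.omega_le hR.1 hle j, hR.2]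

/-- Two comparable exponents with small divisors are far apart. -/
theorem degree_gap [Nonempty ι] (h : HasNoResonance μ) {v : ℕ} {c : ℝ} {j : Fin n} (hc : 4 * c ≤ omega μ v)
    (hμ : ∀ a, 2 * c ≤ ‖μ a j‖) {Q R : Fin n →₀ ℕ}
    (hQ : Q ∈ smallExponents μ c j) (hR : R ∈ smallExponents μ c j) (hQR : Q < R) :
    Q.degree + 2 ^ v ≤ R.degree := by
  obtain ⟨P, rfl⟩ := exists_add_of_le hQR.le
  have hP : 1 ≤ P.degree := by
    rw [Nat.one_le_iff_ne_zero, Ne, Finsupp.degree_eq_zero_iff]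
    rintro rfl
    simp at hQR
  -- If `Q` and `Q + P` both nearly resonate with `j`, then `μ ^ P` is nearly `1`, so `P + e_j`
  -- nearly resonates as well. The bound `2 * c ≤ ‖μ a j‖` keeps `‖μ ^ Q‖` at least half of `‖μ a
  -- j‖`, at the cost of a factor two.
  have hdiv : smallDivisor μ (P + Finsupp.single j 1) j < 4 * c := by
    obtain ⟨a, ha⟩ := exists_smallDivisor_eq μ (P + Finsupp.single j 1) j
    rw [← ha, monom_add, monom_single]
    have h1 := (le_smallDivisor a Q j).trans_lt hQ.2
    have h2 := (le_smallDivisor a (Q + P) j).trans_lt hR.2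
    rw [monom_add] at h2
    have h3 : ‖monom (μ a) Q * (monom (μ a) P - 1)‖ < 2 * c := by
      have : monom (μ a) Q * (monom (μ a) P - 1) =
        (monom (μ a) Q * monom (μ a) P - μ a j) - (monom (μ a) Q - μ a j) := by ring
      rw [this]
      exact (norm_sub_le _ _).trans_lt (by linarith)
    have h4 : ‖μ a j‖ / 2 ≤ ‖monom (μ a) Q‖ := by
      have := norm_sub_norm_le (μ a j) (μ a j - monom (μ a) Q)
      rw [sub_sub_cancel, norm_sub_rev (μ a j)] at this
      linarith [hμ a]
    have h5 : monom (μ a) P * μ a j - μ a j = μ a j * (monom (μ a) P - 1) := by ring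
    rw [h5, norm_mul]
    rw [norm_mul] at h3
    have h6 := mul_le_mul_of_nonneg_right h4 (norm_nonneg (monom (μ a) P - 1))
    linarith
  by_contra! hlt
  rw [map_add] at hlt
  have h7 := h.omega_le (Q := P + Finsupp.single j 1) (v := v)
    (by rw [map_add, Finsupp.degree_single]; omega)
    (by rw [map_add, Finsupp.degree_single]; omega) j
  linarith

end SmallDivisors

/-! ### The weight that absorbs the small divisors -/

section Weights

variable {n : ℕ} {ι : Type*} {μ : ι → V n}

/-- Twice the shifted Brjuno series minus the series itself. These increments are the costs of the
successive scales. -/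
theorem summable_log_omega_sub (hdioph : IsDiophantine μ) :
    Summable fun v : ℕ =>
      (Real.log (omega μ (v + 1)) - Real.log (omega μ (v + 2))) / 2 ^ (v + 1) := by
  have h1 := ((summable_nat_add_iff 1).mpr hdioph).mul_left 2
  refine (h1.sub hdioph).congr fun v => ?_
  field_simp
  ring

variable [Finite ι]

theorem exists_small_constant [Nonempty ι] [Nonempty (Fin n)] (hμ : ∀ a k, μ a k ≠ 0) :
    ∃ c : ℝ, 0 < c ∧ ∀ a k, c ≤ ‖μ a k‖ := by
  obtain ⟨p, hp⟩ := Finite.exists_min fun p : ι × Fin n => ‖μ p.1 p.2‖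
  exact ⟨‖μ p.1 p.2‖, norm_pos_iff.mpr (hμ _ _), fun a k => hp (a, k)⟩

/-- The small divisors are bounded below by the total contribution of the scales at which they
are small. -/
theorem exp_neg_tsum_le_smallDivisor [Nonempty (Fin n)] (h : HasNoResonance μ) {θ : ℝ}
    (hθ : 0 < θ) (hθ1 : θ ≤ 1) (Q : Fin n →₀ ℕ) (k : Fin n) (hQ : 2 ≤ Q.degree)
    (hs : Summable fun v : ℕ => (Real.log (omega μ (v + 1)) - Real.log (omega μ (v + 2))) *
      (smallExponents μ (θ * omega μ (v + 1)) k).indicator 1 Q) :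
    θ * omega μ 1 * Real.exp (-∑' v : ℕ, (Real.log (omega μ (v + 1)) -
      Real.log (omega μ (v + 2))) * (smallExponents μ (θ * omega μ (v + 1)) k).indicator 1 Q) ≤
      smallDivisor μ Q k := by
  classical
  have hle : ∀ v, θ * omega μ (v + 1) ≤ omega μ (v + 1) := fun v =>
    mul_le_of_le_one_left (omega_pos h v).le hθ1
  -- The first scale at which `Q` is no longer small bounds its divisor from below. Up to that scale
  -- every indicator is `1`, and the increments telescope.
  have hex : ∃ v : ℕ, Q ∉ smallExponents μ (θ * omega μ (v + 1)) k := by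
    refine ⟨Q.degree, fun hmem => ?_⟩
    have h1 := lt_degree_of_mem_smallExponents h (hle _) hmem
    have h2 : Q.degree < 2 ^ Q.degree := Nat.lt_two_pow_self
    have h3 : 2 ^ Q.degree ≤ 2 ^ (Q.degree + 1) := Nat.pow_le_pow_right two_pos (Nat.le_succ _)
    omega
  have hN : θ * omega μ (Nat.find hex + 1) ≤ smallDivisor μ Q k := by
    by_contra! hlt
    exact Nat.find_spec hex ⟨hQ, hlt⟩
  refine le_trans ?_ hN
  rw [mul_assoc]
  refine mul_le_mul_of_nonneg_left ?_ hθ.le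
  have hsum : Real.log (omega μ 1) - Real.log (omega μ (Nat.find hex + 1)) ≤
      ∑' v : ℕ, (Real.log (omega μ (v + 1)) - Real.log (omega μ (v + 2))) *
        (smallExponents μ (θ * omega μ (v + 1)) k).indicator 1 Q := by
    rw [← Finset.sum_range_sub' (fun v => Real.log (omega μ (v + 1))) (Nat.find hex)]
    calc _ = ∑ v ∈ Finset.range (Nat.find hex),
          (Real.log (omega μ (v + 1)) - Real.log (omega μ (v + 2))) *
            (smallExponents μ (θ * omega μ (v + 1)) k).indicator 1 Q := by
          refine Finset.sum_congr rfl fun v hv => ?_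
          have hv' := not_not.mp (Nat.find_min hex (Finset.mem_range.mp hv))
          rw [Set.indicator_of_mem hv', Pi.one_apply, mul_one]
      _ ≤ _ := hs.sum_le_tsum _ fun v _ => mul_nonneg
          (sub_nonneg.mpr (Real.log_le_log (omega_pos h (v + 1)) (omega_antitone h v)))
          (Set.indicator_nonneg (fun _ _ => zero_le_one) _)
  calc omega μ 1 * Real.exp (-_)
      ≤ omega μ 1 * Real.exp (-(Real.log (omega μ 1) - Real.log (omega μ (Nat.find hex + 1)))) :=
        mul_le_mul_of_nonneg_left (Real.exp_le_exp.mpr (neg_le_neg hsum)) (omega_pos h 0).le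
    _ = omega μ (Nat.find hex + 1) := by
        have h0 := omega_pos h 0
        rw [neg_sub, Real.exp_sub, Real.exp_log (omega_pos h _), Real.exp_log h0]
        field_simp

/-- A weight compensating the small divisors of a non-resonant diophantine family: it decreases at
most geometrically, and its defect of multiplicativity absorbs each small divisor. -/
theorem exists_weight [Nonempty ι] (h : HasNoResonance μ) (hμ : ∀ a k, μ a k ≠ 0) (hdioph : IsDiophantine μ) :
    ∃ (w : (Fin n →₀ ℕ) → ℝ) (κ A : ℝ), 0 < κ ∧ 0 < A ∧ (∀ Q, κ ^ Q.degree ≤ w Q) ∧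
      (∀ Q, w Q ≤ 1) ∧ ∀ (Q : Fin n →₀ ℕ) (k : Fin n), 2 ≤ Q.degree →
        ∀ (J : Type) [Fintype J] (q : J → Fin n →₀ ℕ), (∀ i, q i < Q) → ∑ i, q i = Q →
          w Q ≤ smallDivisor μ Q k * (A * ∏ i, w (q i)) := by
  rcases isEmpty_or_nonempty (Fin n) with hn | hn
  · exact ⟨1, 1, 1, one_pos, one_pos, by simp, by simp, fun Q k => (hn.false k).elim⟩
  obtain ⟨c, hc, hcμ⟩ := exists_small_constant hμ
  have hω := omega_pos h
  -- The two conditions on `θ` are the hypotheses of `degree_gap` with threshold `θ * omega μ (v +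
  -- 1)`, uniformly in `v` because `omega` decreases.
  obtain ⟨θ, hθ, hθ4, hθc⟩ : ∃ θ : ℝ, 0 < θ ∧ 4 * θ ≤ 1 ∧ 2 * (θ * omega μ 1) ≤ c := by
    refine ⟨min (1 / 4) (c / (2 * omega μ 1)), ?_, ?_, ?_⟩
    · have := hω 0
      positivity
    · linarith [min_le_left (1 / 4) (c / (2 * omega μ 1))]
    · have h1 := min_le_right (1 / 4) (c / (2 * omega μ 1))
      rw [le_div_iff₀ (by have := hω 0; positivity)] at h1
      linarith
  have hω1 : ∀ v, omega μ (v + 1) ≤ omega μ 1 := by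
    intro v
    induction v with
    | zero => exact le_rfl
    | succ v ih => exact (omega_antitone h v).trans ih
  let b : ℕ → ℝ := fun v => Real.log (omega μ (v + 1)) - Real.log (omega μ (v + 2))
  have hb : ∀ v, 0 ≤ b v := fun v =>
    sub_nonneg.mpr (Real.log_le_log (hω (v + 1)) (omega_antitone h v))
  have hbs : Summable fun v => b v / 2 ^ (v + 1) := summable_log_omega_sub hdioph
  let m : ℕ → ℝ := fun v => 2 ^ (v + 1)
  have hm : ∀ v, 0 < m v := fun v => by positivity
  let C : ℕ → Fin n → Set (Fin n →₀ ℕ) := fun v j => smallExponents μ (θ * omega μ (v + 1)) j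
  have hC : ∀ v j, ∀ R ∈ C v j, m v ≤ R.degree := by
    intro v j R hR
    have h1 := lt_degree_of_mem_smallExponents h (v := v + 1)
      (mul_le_of_le_one_left (hω v).le (by linarith)) hR
    have h2 : ((2 ^ (v + 1) : ℕ) : ℝ) ≤ R.degree := by exact_mod_cast h1.le
    simpa [m] using h2
  have hgap : ∀ v j, ∀ Q ∈ C v j, ∀ R ∈ C v j, Q < R → (Q.degree : ℝ) + m v ≤ R.degree := by
    intro v j Q hQ R hR hQR
    have h1 := degree_gap h (v := v + 1) (c := θ * omega μ (v + 1)) (j := j)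
      (by nlinarith [hω v]) (fun a => by nlinarith [hω1 v, hcμ a j]) hQ hR hQR
    have h2 : ((Q.degree + 2 ^ (v + 1) : ℕ) : ℝ) ≤ R.degree := by exact_mod_cast h1
    simpa [m] using h2
  -- The gap holds only between exponents that are small for the same direction `j`, so each
  -- direction has its own potential.
  let p : ℕ → (Fin n →₀ ℕ) → ℝ := fun v Q => ∑ j, potential (m v) (C v j) Q
  have hp0 : ∀ v Q, 0 ≤ p v Q := fun v Q =>
    Finset.sum_nonneg fun j _ => potential_nonneg (hm v) (hC v j) Q
  have hple : ∀ v Q, b v * p v Q ≤ (2 * n * Q.degree) * (b v / 2 ^ (v + 1)) := by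
    intro v Q
    have h1 : p v Q ≤ n * (2 * Q.degree / m v) := by
      calc p v Q ≤ ∑ _j : Fin n, 2 * Q.degree / m v := Finset.sum_le_sum fun j _ =>
            (potential_le_profile (hm v) (hC v j) Q).trans (profile_le (hm v) _)
        _ = n * (2 * Q.degree / m v) := by simp
    calc b v * p v Q ≤ b v * (n * (2 * Q.degree / m v)) := mul_le_mul_of_nonneg_left h1 (hb v)
      _ = _ := by
        change b v * (n * (2 * Q.degree / 2 ^ (v + 1))) = _
        ring
  have hps : ∀ Q, Summable fun v => b v * p v Q := fun Q =>
    Summable.of_nonneg_of_le (fun v => mul_nonneg (hb v) (hp0 v Q)) (fun v => hple v Q)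
      (hbs.mul_left _)
  -- Total cost over all scales. It is at most linear in the degree, since the count at scale `v` is
  -- at most `2 * n * Q.degree / 2 ^ (v + 1)` and the Brjuno condition sums the `b v / 2 ^ (v + 1)`.
  let U : (Fin n →₀ ℕ) → ℝ := fun Q => ∑' v, b v * p v Q
  have hU0 : ∀ Q, 0 ≤ U Q := fun Q => tsum_nonneg fun v => mul_nonneg (hb v) (hp0 v Q)
  have hUle : ∀ Q, U Q ≤ (2 * n * ∑' v, b v / 2 ^ (v + 1)) * Q.degree := by
    intro Q
    calc U Q ≤ ∑' v, (2 * n * Q.degree) * (b v / 2 ^ (v + 1)) :=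
          (hps Q).tsum_le_tsum (fun v => hple v Q) (hbs.mul_left _)
      _ = _ := by
        rw [tsum_mul_left]
        ring
  refine ⟨fun Q => Real.exp (-U Q), Real.exp (-(2 * n * ∑' v, b v / 2 ^ (v + 1))),
    (θ * omega μ 1)⁻¹, Real.exp_pos _, inv_pos.mpr (mul_pos hθ (hω 0)), fun Q => ?_, fun Q => ?_,
    fun Q k hQ J _ q hq hqQ => ?_⟩
  · rw [← Real.exp_nat_mul, Real.exp_le_exp]
    linarith [hUle Q]
  · rw [Real.exp_le_one_iff]
    linarith [hU0 Q]
  · have hmain : ∀ v, b v * (C v k).indicator 1 Q + ∑ i, b v * p v (q i) ≤ b v * p v Q := by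
      intro v
      rw [← Finset.mul_sum, ← mul_add]
      refine mul_le_mul_of_nonneg_left ?_ (hb v)
      have h1 : ∑ i, p v (q i) = ∑ j, ∑ i, potential (m v) (C v j) (q i) := Finset.sum_comm
      have h2 : (C v k).indicator (1 : (Fin n →₀ ℕ) → ℝ) Q ≤ ∑ j, (C v j).indicator 1 Q :=
        Finset.single_le_sum (f := fun j => (C v j).indicator (1 : (Fin n →₀ ℕ) → ℝ) Q)
          (fun j _ => Set.indicator_nonneg (fun _ _ => zero_le_one) _) (Finset.mem_univ k)
      calc _ ≤ ∑ j, (C v j).indicator (1 : (Fin n →₀ ℕ) → ℝ) Q +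
            ∑ j, ∑ i, potential (m v) (C v j) (q i) := by
            rw [h1]
            linarith
        _ ≤ p v Q := by
            rw [← Finset.sum_add_distrib]
            exact Finset.sum_le_sum fun j _ =>
              indicator_add_sum_potential_le (hm v) (hC v j) (hgap v j) hq hqQ
    have hsi : Summable fun v => b v * (C v k).indicator 1 Q :=
      Summable.of_nonneg_of_le
        (fun v => mul_nonneg (hb v) (Set.indicator_nonneg (fun _ _ => zero_le_one) _))
        (fun v => le_trans (le_add_of_nonneg_right
          (Finset.sum_nonneg fun i _ => mul_nonneg (hb v) (hp0 v _))) (hmain v)) (hps Q)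
    have hUsum : ∑' v, b v * (C v k).indicator 1 Q + ∑ i, U (q i) ≤ U Q := by
      rw [← Summable.tsum_finsetSum fun i _ => hps (q i),
        ← hsi.tsum_add (summable_sum fun i _ => hps (q i))]
      exact (hsi.add (summable_sum fun i _ => hps (q i))).tsum_le_tsum hmain (hps Q)
    have hdiv := exp_neg_tsum_le_smallDivisor h hθ (by linarith) Q k hQ hsi
    have hθω : 0 < θ * omega μ 1 := mul_pos hθ (hω 0)
    rw [← Real.exp_sum]
    calc Real.exp (-U Q)
        ≤ Real.exp (-∑' v, b v * (C v k).indicator 1 Q) * Real.exp (∑ i, -U (q i)) := by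
          rw [← Real.exp_add, Real.exp_le_exp, Finset.sum_neg_distrib]
          linarith
      _ = θ * omega μ 1 * Real.exp (-∑' v, b v * (C v k).indicator 1 Q) *
            ((θ * omega μ 1)⁻¹ * Real.exp (∑ i, -U (q i))) := by
          rw [mul_mul_mul_comm, mul_inv_cancel₀ hθω.ne', one_mul]
      _ ≤ _ := mul_le_mul_of_nonneg_right hdiv (by positivity)

end Weights

/-! ### Series with coefficients in `[0, ∞]` and the majorant method -/

section PositiveSeries

variable {n : ℕ}

/-- The value at `(x, …, x)` of a power series with coefficients in `[0, ∞]`. -/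
noncomputable def diagEval (x : ℝ≥0∞) (g : MvPowerSeries (Fin n) ℝ≥0∞) : ℝ≥0∞ :=
  ∑' Q, MvPowerSeries.coeff Q g * x ^ Q.degree

theorem diagEval_one (x : ℝ≥0∞) : diagEval x (1 : MvPowerSeries (Fin n) ℝ≥0∞) = 1 := by
  classical
  unfold diagEval
  rw [tsum_eq_single 0]
  · simp
  · intro Q hQ
    simp [MvPowerSeries.coeff_one, hQ]

theorem diagEval_mul (x : ℝ≥0∞) (g h : MvPowerSeries (Fin n) ℝ≥0∞) :
    diagEval x (g * h) = diagEval x g * diagEval x h := by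
  classical
  unfold diagEval
  rw [← ENNReal.tsum_mul_right]
  simp_rw [← ENNReal.tsum_mul_left]
  rw [← ENNReal.tsum_prod' (f := fun p : (Fin n →₀ ℕ) × (Fin n →₀ ℕ) =>
      MvPowerSeries.coeff p.1 g * x ^ p.1.degree * (MvPowerSeries.coeff p.2 h * x ^ p.2.degree)),
    ← Finset.HasAntidiagonal.sigmaAntidiagonalEquivProd.tsum_eq, ENNReal.tsum_sigma']
  refine tsum_congr fun Q => ?_
  rw [tsum_fintype, MvPowerSeries.coeff_mul, Finset.sum_mul, ← Finset.sum_coe_sort]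
  refine Finset.sum_congr rfl fun p _ => ?_
  obtain ⟨⟨P, R⟩, hp⟩ := p
  rw [Finset.HasAntidiagonal.mem_antidiagonal] at hp
  simp only [Finset.HasAntidiagonal.sigmaAntidiagonalEquivProd_apply]
  rw [← hp, map_add, pow_add]
  ring

theorem diagEval_prod {J : Type*} (x : ℝ≥0∞) (s : Finset J)
    (g : J → MvPowerSeries (Fin n) ℝ≥0∞) :
    diagEval x (∏ i ∈ s, g i) = ∏ i ∈ s, diagEval x (g i) := by
  classical
  induction s using Finset.induction_on with
  | empty => simp [diagEval_one]
  | insert a s ha ih => rw [Finset.prod_insert ha, Finset.prod_insert ha, diagEval_mul, ih]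

/-- The part of degree at most `N` of a power series. -/
noncomputable def truncDegree (N : ℕ) (g : MvPowerSeries (Fin n) ℝ≥0∞) :
    MvPowerSeries (Fin n) ℝ≥0∞ :=
  fun Q => if Q.degree ≤ N then MvPowerSeries.coeff Q g else 0

theorem coeff_truncDegree (N : ℕ) (g : MvPowerSeries (Fin n) ℝ≥0∞) (Q : Fin n →₀ ℕ) :
    MvPowerSeries.coeff Q (truncDegree N g) =
      if Q.degree ≤ N then MvPowerSeries.coeff Q g else 0 := rfl

theorem diagEval_le_of_truncDegree_le {x c : ℝ≥0∞} {g : MvPowerSeries (Fin n) ℝ≥0∞}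
    (h : ∀ N, diagEval x (truncDegree N g) ≤ c) : diagEval x g ≤ c := by
  unfold diagEval
  rw [ENNReal.tsum_eq_iSup_sum]
  refine iSup_le fun s => le_trans ?_ (h (s.sup fun Q => Q.degree))
  refine le_trans (Finset.sum_le_sum fun Q hQ => ?_) (ENNReal.sum_le_tsum s)
  rw [coeff_truncDegree, if_pos (Finset.le_sup (f := fun Q : Fin n →₀ ℕ => Q.degree) hQ)]

/-- The part of degree at least two of a power series. -/
noncomputable def nonlinearCoeff {S : Type*} [Semiring S] (f : MvPowerSeries (Fin n) S)
    (R : Fin n →₀ ℕ) : S :=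
  if R.degree < 2 then 0 else MvPowerSeries.coeff R f

/-- The nonlinear part at `2 * x` is at most `(2 * x / r) ^ 2` times the value at `r`. Being
quadratic in `x`, it drops below `x` for small `x`. -/
theorem exists_radius {f : MvPowerSeries (Fin n) ℝ≥0∞} {r : ℝ} (hr : 0 < r)
    (hf : diagEval (ENNReal.ofReal r) f ≠ ⊤) :
    ∃ x : ℝ, 0 < x ∧
      ∑' R, nonlinearCoeff f R * (2 * ENNReal.ofReal x) ^ R.degree ≤ ENNReal.ofReal x := by
  obtain ⟨K, hK⟩ : ∃ K : ℝ, 0 ≤ K ∧ diagEval (ENNReal.ofReal r) f = ENNReal.ofReal K :=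
    ⟨_, ENNReal.toReal_nonneg, (ENNReal.ofReal_toReal hf).symm⟩
  let x : ℝ := min (r / 2) (r ^ 2 / (4 * K + 1))
  have hK1 : 0 < 4 * K + 1 := by linarith [hK.1]
  have hx : 0 < x := lt_min (by positivity) (by positivity)
  have hx1 : 2 * x ≤ r := by linarith [min_le_left (r / 2) (r ^ 2 / (4 * K + 1))]
  have hx2 : (2 * x / r) ^ 2 * K ≤ x := by
    have h1 : x * (4 * K + 1) ≤ r ^ 2 := (le_div_iff₀ hK1).mp (min_le_right _ _)
    rw [div_pow, div_mul_eq_mul_div, div_le_iff₀ (by positivity)]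
    nlinarith [hK.1]
  refine ⟨x, hx, ?_⟩
  have hterm : ∀ R : Fin n →₀ ℕ, nonlinearCoeff f R * (2 * ENNReal.ofReal x) ^ R.degree ≤
      ENNReal.ofReal ((2 * x / r) ^ 2) *
        (MvPowerSeries.coeff R f * ENNReal.ofReal r ^ R.degree) := by
    intro R
    unfold nonlinearCoeff
    split_ifs with hR
    · simp
    · have h2 : 2 * ENNReal.ofReal x = ENNReal.ofReal (2 * x) := by
        rw [ENNReal.ofReal_mul zero_le_two, ENNReal.ofReal_ofNat]
      have h3 : (2 * x) ^ R.degree ≤ (2 * x / r) ^ 2 * r ^ R.degree := by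
        obtain ⟨d, hd⟩ := Nat.exists_eq_add_of_le (not_lt.mp hR)
        rw [hd, pow_add, pow_add, ← mul_assoc, ← mul_pow, div_mul_cancel₀ _ hr.ne']
        gcongr
      rw [h2, ← ENNReal.ofReal_pow (by positivity), ← ENNReal.ofReal_pow hr.le]
      calc _ ≤ MvPowerSeries.coeff R f * ENNReal.ofReal ((2 * x / r) ^ 2 * r ^ R.degree) := by
            gcongr
        _ = _ := by
            rw [ENNReal.ofReal_mul (by positivity)]
            ring
  calc _ ≤ ∑' R : Fin n →₀ ℕ, ENNReal.ofReal ((2 * x / r) ^ 2) *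
        (MvPowerSeries.coeff R f * ENNReal.ofReal r ^ R.degree) := ENNReal.tsum_le_tsum hterm
    _ = ENNReal.ofReal ((2 * x / r) ^ 2 * K) := by
        rw [ENNReal.tsum_mul_left, ENNReal.ofReal_mul (by positivity), ← hK.2]
        rfl
    _ ≤ _ := ENNReal.ofReal_le_ofReal hx2

/-- The majorant method: a tuple of nonnegative power series that is dominated by
`X + f(g)` with `f` convergent without linear part converges. -/
theorem diagEval_le_of_majorant {g : Fin n → MvPowerSeries (Fin n) ℝ≥0∞}
    {f : MvPowerSeries (Fin n) ℝ≥0∞} {x : ℝ≥0∞}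
    (hg0 : ∀ k, MvPowerSeries.constantCoeff (g k) = 0)
    (hg1 : ∀ k l, MvPowerSeries.coeff (Finsupp.single l 1) (g k) ≤ if l = k then 1 else 0)
    (hg : ∀ k (Q : Fin n →₀ ℕ), 2 ≤ Q.degree → MvPowerSeries.coeff Q (g k) ≤
      ∑' R, nonlinearCoeff f R * MvPowerSeries.coeff Q (∏ i : Factors R, g i.1))
    (hx : ∑' R, nonlinearCoeff f R * (2 * x) ^ R.degree ≤ x) (k : Fin n) :
    diagEval x (g k) ≤ 2 * x := by
  classical
  refine diagEval_le_of_truncDegree_le fun N => ?_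
  -- Truncations are bounded by induction on the degree: each product has at least two factors, so
  -- degree `N + 1` of `g` involves only degrees up to `N` of the factors. The bound `2 * x`
  -- reproduces itself as `x` from the linear term plus `x` from `hx`.
  induction N generalizing k with
  | zero =>
    refine le_of_eq_of_le (ENNReal.tsum_eq_zero.mpr fun Q => ?_) zero_le
    rw [coeff_truncDegree]
    split_ifs with hQ
    · have hQ0 : Q = 0 := by
        rw [← Finsupp.degree_eq_zero_iff]
        omega
      rw [hQ0, MvPowerSeries.coeff_zero_eq_constantCoeff_apply, hg0, zero_mul]
    · exact zero_mul _
  | succ N ih =>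
    have htrunc0 : ∀ l, MvPowerSeries.constantCoeff (truncDegree N (g l)) = 0 := by
      intro l
      rw [← MvPowerSeries.coeff_zero_eq_constantCoeff_apply, coeff_truncDegree,
        MvPowerSeries.coeff_zero_eq_constantCoeff_apply, hg0, ite_self]
    have hterm : ∀ Q : Fin n →₀ ℕ,
        MvPowerSeries.coeff Q (truncDegree (N + 1) (g k)) * x ^ Q.degree ≤
        (if Q = Finsupp.single k 1 then x else 0) + ∑' R, nonlinearCoeff f R *
          (MvPowerSeries.coeff Q (∏ i : Factors R, truncDegree N (g i.1)) * x ^ Q.degree) := by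
      intro Q
      rw [coeff_truncDegree]
      split_ifs with hQN hQk hQk
      · refine le_add_right ?_
        rw [hQk, Finsupp.degree_single, pow_one]
        have := hg1 k k
        rw [if_pos rfl] at this
        exact mul_le_of_le_one_left zero_le this
      · rw [zero_add]
        rcases Nat.lt_or_ge Q.degree 2 with hQ | hQ
        · rcases degree_lt_two_cases hQ with rfl | ⟨l, rfl⟩
          · rw [MvPowerSeries.coeff_zero_eq_constantCoeff_apply, hg0, zero_mul]
            exact zero_le
          · have hlk : l ≠ k := fun h => hQk (by rw [h])
            have := hg1 k l
            rw [if_neg hlk] at this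
            rw [le_antisymm this zero_le, zero_mul]
            exact zero_le
        · refine (mul_le_mul_left (hg k Q hQ) _).trans ?_
          rw [← ENNReal.tsum_mul_right]
          refine ENNReal.tsum_le_tsum fun R => ?_
          rw [mul_assoc]
          by_cases hR : R.degree < 2
          · simp [nonlinearCoeff, hR]
          · have := nontrivial_factors (not_lt.mp hR)
            rw [coeff_prod_congr_of_lt (a := fun i : Factors R => g i.1)
              (b := fun i : Factors R => truncDegree N (g i.1)) (fun i => hg0 i.1)
              (fun i => htrunc0 i.1)]
            intro i P hP
            rw [coeff_truncDegree, if_pos (by omega)]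
      · rw [zero_mul]
        exact zero_le
      · rw [zero_mul]
        exact zero_le
    calc diagEval x (truncDegree (N + 1) (g k))
        ≤ ∑' Q : Fin n →₀ ℕ, ((if Q = Finsupp.single k 1 then x else 0) +
            ∑' R, nonlinearCoeff f R *
          (MvPowerSeries.coeff Q (∏ i : Factors R, truncDegree N (g i.1)) * x ^ Q.degree)) :=
          ENNReal.tsum_le_tsum hterm
      _ = x + ∑' R, nonlinearCoeff f R *
            diagEval x (∏ i : Factors R, truncDegree N (g i.1)) := by
          rw [ENNReal.tsum_add, tsum_ite_eq, ENNReal.tsum_comm]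
          simp_rw [ENNReal.tsum_mul_left]
          rfl
      _ ≤ x + ∑' R, nonlinearCoeff f R * (2 * x) ^ R.degree := by
          gcongr with R
          rw [diagEval_prod]
          refine (Finset.prod_le_prod' fun i _ => ih i.1).trans_eq ?_
          rw [Finset.prod_const, Finset.card_univ, card_factors]
      _ ≤ x + x := by gcongr
      _ = 2 * x := (two_mul x).symm

end PositiveSeries

/-! ### Siegel's estimate and convergence of the linearizing series -/

section WeightedSeries

variable {n : ℕ}

/-- The series of the weighted absolute values of the coefficients of `g`. -/
noncomputable def weighted (W : (Fin n →₀ ℕ) → ℝ≥0∞) (g : MvPowerSeries (Fin n) ℂ) :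
    MvPowerSeries (Fin n) ℝ≥0∞ :=
  fun Q => ‖MvPowerSeries.coeff Q g‖ₑ * W Q

theorem coeff_weighted (W : (Fin n →₀ ℕ) → ℝ≥0∞) (g : MvPowerSeries (Fin n) ℂ)
    (Q : Fin n →₀ ℕ) :
    MvPowerSeries.coeff Q (weighted W g) = ‖MvPowerSeries.coeff Q g‖ₑ * W Q := rfl

theorem enorm_coeff_prod_le {J : Type*} [Fintype J] (g : J → MvPowerSeries (Fin n) ℂ)
    (Q : Fin n →₀ ℕ) :
    ‖MvPowerSeries.coeff Q (∏ i, g i)‖ₑ ≤ MvPowerSeries.coeff Q (∏ i, weighted 1 (g i)) := by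
  classical
  rw [MvPowerSeries.coeff_prod, MvPowerSeries.coeff_prod]
  refine (enorm_sum_le _ _).trans_eq (Finset.sum_congr rfl fun q _ => ?_)
  simp [coeff_weighted, enorm_eq_nnnorm, nnnorm_prod]

/-- The weight inequality is needed only for decompositions into proper parts: without constant
terms, a decomposition with a zero part contributes nothing, and otherwise each part is strictly
below `Q`. -/
theorem enorm_coeff_prod_mul_le {J : Type*} [Fintype J] [Nontrivial J]
    {g : J → MvPowerSeries (Fin n) ℂ} (hg : ∀ i, MvPowerSeries.constantCoeff (g i) = 0)
    {W : (Fin n →₀ ℕ) → ℝ≥0∞} {c : ℝ≥0∞} {Q : Fin n →₀ ℕ}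
    (hW : ∀ q : J → Fin n →₀ ℕ, (∀ i, q i < Q) → ∑ i, q i = Q → W Q ≤ c * ∏ i, W (q i)) :
    ‖MvPowerSeries.coeff Q (∏ i, g i)‖ₑ * W Q ≤
      c * MvPowerSeries.coeff Q (∏ i, weighted W (g i)) := by
  classical
  refine (mul_le_mul_left (enorm_coeff_prod_le g Q) _).trans ?_
  rw [MvPowerSeries.coeff_prod, MvPowerSeries.coeff_prod, Finset.sum_mul, Finset.mul_sum]
  refine Finset.sum_le_sum fun q hq => ?_
  rw [Finset.mem_finsuppAntidiag] at hq
  by_cases h0 : ∃ j, q j = 0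
  · obtain ⟨j, hj⟩ := h0
    rw [Finset.prod_eq_zero (Finset.mem_univ j), zero_mul]
    · exact zero_le
    · rw [coeff_weighted, hj, MvPowerSeries.coeff_zero_eq_constantCoeff_apply, hg]
      simp
  · push Not at h0
    have hlt : ∀ i, q i < Q := by
      intro i
      obtain ⟨j, hj⟩ := exists_ne i
      have hle : q i + q j ≤ Q := by
        rw [← hq.1, ← Finset.sum_pair (f := q) hj.symm]
        exact Finset.sum_le_sum_of_subset (Finset.subset_univ _)
      exact (lt_add_of_pos_right _ (pos_iff_ne_zero.mpr (h0 j))).trans_le hle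
    calc _ ≤ (∏ i, MvPowerSeries.coeff (q i) (weighted 1 (g i))) * (c * ∏ i, W (q i)) :=
          mul_le_mul_right (hW q hlt hq.1) _
      _ = c * ∏ i, MvPowerSeries.coeff (q i) (weighted W (g i)) := by
          simp only [coeff_weighted, Pi.one_apply, mul_one, Finset.prod_mul_distrib]
          ring

theorem enorm_coeff_subst_le {g : Fin n → MvPowerSeries (Fin n) ℂ}
    (hg : ∀ i, MvPowerSeries.constantCoeff (g i) = 0) (f : MvPowerSeries (Fin n) ℂ)
    (Q : Fin n →₀ ℕ) :
    ‖MvPowerSeries.coeff Q (f.subst g)‖ₑ ≤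
      ∑' R, ‖MvPowerSeries.coeff R f‖ₑ *
        ‖MvPowerSeries.coeff Q (∏ i : Factors R, g i.1)‖ₑ := by
  have hs := MvPowerSeries.hasSubst_of_constantCoeff_zero hg
  rw [MvPowerSeries.coeff_subst hs,
    finsum_eq_sum _ (MvPowerSeries.coeff_subst_finite hs f Q)]
  refine (enorm_sum_le _ _).trans (le_of_eq_of_le ?_
    (ENNReal.sum_le_tsum (MvPowerSeries.coeff_subst_finite hs f Q).toFinset))
  refine Finset.sum_congr rfl fun R _ => ?_
  rw [finsuppProd_pow_eq_prod_factors, enorm_smul]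

/-- Siegel's estimate: if `T_a ∘ g = g ∘ diag(μ_a)` for all `a`, the coefficients of `g` are
dominated by those of a composition, up to small divisors. -/
theorem smallDivisor_mul_coeff_le {ι : Type*} [Fintype ι] [Nonempty ι] {μ : ι → V n}
    {g : Fin n → MvPowerSeries (Fin n) ℂ} {T : ι → Fin n → MvPowerSeries (Fin n) ℂ}
    (hg : IsTangentToId g) (hT0 : ∀ a k, MvPowerSeries.constantCoeff (T a k) = 0)
    (hT1 : ∀ a k l, MvPowerSeries.coeff (Finsupp.single l 1) (T a k) =
      if l = k then μ a k else 0)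
    (hT : ∀ a k, (T a k).subst g = MvPowerSeries.rescale (μ a) (g k)) (Q : Fin n →₀ ℕ)
    (k : Fin n) :
    ENNReal.ofReal (smallDivisor μ Q k) * ‖MvPowerSeries.coeff Q (g k)‖ₑ ≤
      ∑' R, nonlinearCoeff (∑ a, ∑ l, weighted 1 (T a l)) R *
        ‖MvPowerSeries.coeff Q (∏ i : Factors R, g i.1)‖ₑ := by
  classical
  -- For each `Q` and `k` the conjugacy equation is read with the generator whose divisor is
  -- largest. Summing the majorants over all generators makes the bound independent of this choice.
  obtain ⟨a, ha⟩ := exists_smallDivisor_eq μ Q k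
  have hs := MvPowerSeries.hasSubst_of_constantCoeff_zero hg.constantCoeff_eq_zero
  have hf : ∀ R : Fin n →₀ ℕ, MvPowerSeries.coeff R (T a k - μ a k • MvPowerSeries.X k) =
      nonlinearCoeff (T a k) R := by
    intro R
    unfold nonlinearCoeff
    split_ifs with hR
    · rcases degree_lt_two_cases hR with rfl | ⟨l, rfl⟩
      · simp [hT0]
      · rw [map_sub, hT1, MvPowerSeries.coeff_smul, MvPowerSeries.coeff_X]
        simp [Finsupp.single_left_inj]
    · have : R ≠ Finsupp.single k 1 := by
        rintro rfl
        simp at hR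
      rw [map_sub, MvPowerSeries.coeff_smul, MvPowerSeries.coeff_X, if_neg this, mul_zero,
        sub_zero]
  have heq : (monom (μ a) Q - μ a k) * MvPowerSeries.coeff Q (g k) =
      MvPowerSeries.coeff Q ((T a k - μ a k • MvPowerSeries.X k).subst g) := by
    rw [MvPowerSeries.subst_sub hs, MvPowerSeries.subst_smul hs, MvPowerSeries.subst_X hs, hT,
      map_sub, MvPowerSeries.coeff_smul, MvPowerSeries.coeff_rescale,
      Finsupp.prod_fintype _ _ (by simp), sub_mul]
    rfl
  calc _ = ‖(monom (μ a) Q - μ a k) * MvPowerSeries.coeff Q (g k)‖ₑ := by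
        rw [enorm_mul, ← ha, ofReal_norm]
    _ ≤ _ := by
        rw [heq]
        refine (enorm_coeff_subst_le hg.constantCoeff_eq_zero _ Q).trans
          (ENNReal.tsum_le_tsum fun R => mul_le_mul_left ?_ _)
        rw [hf]
        unfold nonlinearCoeff
        split_ifs with hR
        · simp
        · calc ‖MvPowerSeries.coeff R (T a k)‖ₑ
              = MvPowerSeries.coeff R (weighted 1 (T a k)) := by simp [coeff_weighted]
            _ ≤ ∑ l, MvPowerSeries.coeff R (weighted 1 (T a l)) :=
              Finset.single_le_sum (f := fun l => MvPowerSeries.coeff R (weighted 1 (T a l)))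
                (fun _ _ => zero_le) (Finset.mem_univ k)
            _ ≤ ∑ b, ∑ l, MvPowerSeries.coeff R (weighted 1 (T b l)) :=
              Finset.single_le_sum
                (f := fun b => ∑ l, MvPowerSeries.coeff R (weighted 1 (T b l)))
                (fun _ _ => zero_le) (Finset.mem_univ a)
            _ = _ := by simp only [map_sum]

theorem diagEval_weighted_one (g : MvPowerSeries (Fin n) ℂ) {r : ℝ} (hr : 0 ≤ r) :
    diagEval (ENNReal.ofReal r) (weighted 1 g) =
      ∑' Q : Fin n →₀ ℕ, ‖‖MvPowerSeries.coeff Q g‖ * r ^ Q.degree‖ₑ := by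
  refine tsum_congr fun Q => ?_
  rw [coeff_weighted, Pi.one_apply, mul_one, enorm_mul, enorm_norm, enorm_pow,
    Real.enorm_of_nonneg hr]

theorem diagEval_weighted_one_ne_top_iff (g : MvPowerSeries (Fin n) ℂ) {r : ℝ} (hr : 0 ≤ r) :
    diagEval (ENNReal.ofReal r) (weighted 1 g) ≠ ⊤ ↔
      Summable fun Q : Fin n →₀ ℕ => ‖MvPowerSeries.coeff Q g‖ * r ^ Q.degree := by
  rw [diagEval_weighted_one g hr, ← summable_norm_iff, ← lt_top_iff_ne_top]
  simp_rw [enorm_eq_nnnorm]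
  rw [lt_top_iff_ne_top, ENNReal.tsum_coe_ne_top_iff_summable, ← NNReal.summable_coe]
  rfl

/-- Convergence of the linearizing series of a non-resonant diophantine family. -/
theorem exists_summable_of_isDiophantine {ι : Type*} [Fintype ι] [Nonempty ι] {μ : ι → V n}
    (h : HasNoResonance μ) (hμ : ∀ a k, μ a k ≠ 0) (hdioph : IsDiophantine μ)
    {g : Fin n → MvPowerSeries (Fin n) ℂ} {T : ι → Fin n → MvPowerSeries (Fin n) ℂ}
    (hg : IsTangentToId g) (hT0 : ∀ a k, MvPowerSeries.constantCoeff (T a k) = 0)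
    (hT1 : ∀ a k l, MvPowerSeries.coeff (Finsupp.single l 1) (T a k) =
      if l = k then μ a k else 0)
    (hT : ∀ a k, (T a k).subst g = MvPowerSeries.rescale (μ a) (g k)) {r : ℝ} (hr : 0 < r)
    (hTr : ∀ a k, Summable fun Q : Fin n →₀ ℕ =>
      ‖MvPowerSeries.coeff Q (T a k)‖ * r ^ Q.degree) :
    ∃ s : ℝ, 0 < s ∧ ∀ k, Summable fun Q : Fin n →₀ ℕ =>
      ‖MvPowerSeries.coeff Q (g k)‖ * s ^ Q.degree := by
  classical
  obtain ⟨w, κ, A, hκ, hA, hκw, hw1, hw⟩ := exists_weight h hμ hdioph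
  let W : (Fin n →₀ ℕ) → ℝ≥0∞ := fun Q => ENNReal.ofReal (w Q)
  have hw0 : ∀ Q, 0 ≤ w Q := fun Q => (by positivity : (0 : ℝ) ≤ κ ^ Q.degree).trans (hκw Q)
  let F : MvPowerSeries (Fin n) ℝ≥0∞ := ∑ a, ∑ l, weighted 1 (T a l)
  let f : MvPowerSeries (Fin n) ℝ≥0∞ := ENNReal.ofReal A • F
  have hf : diagEval (ENNReal.ofReal r) f ≠ ⊤ := by
    have h1 : diagEval (ENNReal.ofReal r) f = ENNReal.ofReal A *
        ∑ a, ∑ l, diagEval (ENNReal.ofReal r) (weighted 1 (T a l)) := by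
      unfold diagEval
      simp only [f, F, MvPowerSeries.coeff_smul, map_sum, Finset.sum_mul, mul_assoc]
      rw [ENNReal.tsum_mul_left, Summable.tsum_finsetSum fun _ _ => ENNReal.summable]
      congr 1
      refine Finset.sum_congr rfl fun a _ => ?_
      rw [Summable.tsum_finsetSum fun _ _ => ENNReal.summable]
    rw [h1]
    refine ENNReal.mul_ne_top ENNReal.ofReal_ne_top ?_
    refine ENNReal.sum_ne_top.mpr fun a _ => ENNReal.sum_ne_top.mpr fun l _ => ?_
    exact (diagEval_weighted_one_ne_top_iff _ hr.le).mpr (hTr a l)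
  obtain ⟨x, hx, hxf⟩ := exists_radius hr hf
  have hmaj : ∀ k, diagEval (ENNReal.ofReal x) (weighted W (g k)) ≤ 2 * ENNReal.ofReal x := by
    refine diagEval_le_of_majorant (f := f) (fun k => ?_) (fun k l => ?_) (fun k Q hQ => ?_) hxf
    · rw [← MvPowerSeries.coeff_zero_eq_constantCoeff_apply, coeff_weighted,
        MvPowerSeries.coeff_zero_eq_constantCoeff_apply, hg.constantCoeff_eq_zero]
      simp
    · rw [coeff_weighted, hg.coeff_single]
      split_ifs
      · simpa [W] using hw1 _
      · simp
    · have hε := h.smallDivisor_pos hQ k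
      have hε' : ENNReal.ofReal (smallDivisor μ Q k) ≠ 0 := by simpa using hε
      -- After multiplication by the divisor, Siegel's estimate bounds the left side, and the weight
      -- inequality returns the same divisor on the right, so that it cancels.
      rw [← ENNReal.mul_le_mul_iff_right hε' ENNReal.ofReal_ne_top, coeff_weighted, ← mul_assoc]
      refine (mul_le_mul_left (smallDivisor_mul_coeff_le hg hT0 hT1 hT Q k) _).trans ?_
      rw [← ENNReal.tsum_mul_right, ← ENNReal.tsum_mul_left]
      refine ENNReal.tsum_le_tsum fun R => ?_
      by_cases hR : R.degree < 2
      · simp [nonlinearCoeff, hR]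
      · have := nontrivial_factors (not_lt.mp hR)
        have hprod := enorm_coeff_prod_mul_le (g := fun i : Factors R => g i.1) (W := W)
          (c := ENNReal.ofReal (smallDivisor μ Q k * A)) (Q := Q)
          (fun i => hg.constantCoeff_eq_zero i.1) (fun q hq hqQ => by
            have h1 := hw Q k hQ (Factors R) q hq hqQ
            rw [← ENNReal.ofReal_prod_of_nonneg fun i _ => hw0 _,
              ← ENNReal.ofReal_mul (by positivity), mul_assoc]
            exact ENNReal.ofReal_le_ofReal h1)
        have hfR : nonlinearCoeff f R = ENNReal.ofReal A * nonlinearCoeff F R := by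
          simp [nonlinearCoeff, hR, f]
        rw [mul_assoc, hfR]
        refine (mul_le_mul_right hprod _).trans_eq ?_
        rw [ENNReal.ofReal_mul hε.le]
        ring
  -- Removing the weight costs a factor `κ` in the radius, because `κ ^ Q.degree ≤ w Q`.
  refine ⟨κ * x, mul_pos hκ hx, fun k => ?_⟩
  rw [← diagEval_weighted_one_ne_top_iff _ (mul_pos hκ hx).le]
  refine ne_top_of_le_ne_top (ENNReal.mul_ne_top ENNReal.ofNat_ne_top ENNReal.ofReal_ne_top)
    (le_trans (ENNReal.tsum_le_tsum fun Q => ?_) (hmaj k))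
  rw [coeff_weighted, coeff_weighted, Pi.one_apply, mul_one, mul_assoc]
  refine mul_le_mul_right ?_ _
  rw [← ENNReal.ofReal_pow (by positivity), ← ENNReal.ofReal_pow hx.le,
    ← ENNReal.ofReal_mul (hw0 Q), mul_pow]
  exact ENNReal.ofReal_le_ofReal (mul_le_mul_of_nonneg_right (hκw Q) (by positivity))

end WeightedSeries

/-! ### Sums of convergent power series as holomorphic germs -/

section ConvergentSeries

variable {n : ℕ}

/-- Absolute convergence of a power series on the closed polydisc of radius `s`. -/
def ConvergesAt (s : ℝ) (g : MvPowerSeries (Fin n) ℂ) : Prop :=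
  Summable fun Q : Fin n →₀ ℕ => ‖MvPowerSeries.coeff Q g‖ * s ^ Q.degree

/-- The sum of a power series. -/
noncomputable def mvSum (g : MvPowerSeries (Fin n) ℂ) (z : V n) : ℂ :=
  ∑' Q, MvPowerSeries.coeff Q g * monom z Q

theorem norm_monom_le {z : V n} {s : ℝ} (hz : ‖z‖ ≤ s) (Q : Fin n →₀ ℕ) :
    ‖monom z Q‖ ≤ s ^ Q.degree := by
  unfold monom
  rw [norm_prod, Finsupp.degree_eq_sum, ← Finset.prod_pow_eq_pow_sum]
  refine Finset.prod_le_prod (fun _ _ => norm_nonneg _) fun l _ => ?_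
  rw [norm_pow]
  gcongr
  exact (norm_le_pi_norm z l).trans hz

theorem monom_const (r : ℂ) (Q : Fin n →₀ ℕ) : monom (fun _ => r) Q = r ^ Q.degree := by
  unfold monom
  rw [Finsupp.degree_eq_sum, ← Finset.prod_pow_eq_pow_sum]

variable {g h : MvPowerSeries (Fin n) ℂ} {s : ℝ}

theorem convergesAt_iff (hs : 0 ≤ s) :
    ConvergesAt s g ↔ diagEval (ENNReal.ofReal s) (weighted 1 g) ≠ ⊤ :=
  (diagEval_weighted_one_ne_top_iff g hs).symm

theorem ConvergesAt.summable_norm (hg : ConvergesAt s g) {z : V n} (hz : ‖z‖ ≤ s) :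
    Summable fun Q => ‖MvPowerSeries.coeff Q g * monom z Q‖ := by
  refine Summable.of_nonneg_of_le (fun _ => norm_nonneg _) (fun Q => ?_) hg
  rw [norm_mul]
  exact mul_le_mul_of_nonneg_left (norm_monom_le hz Q) (norm_nonneg _)

theorem ConvergesAt.hasSum (hg : ConvergesAt s g) {z : V n} (hz : ‖z‖ ≤ s) :
    HasSum (fun Q => MvPowerSeries.coeff Q g * monom z Q) (mvSum g z) :=
  (hg.summable_norm hz).of_norm.hasSum

theorem coeff_weighted_mul_le (Q : Fin n →₀ ℕ) :
    MvPowerSeries.coeff Q (weighted 1 (g * h)) ≤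
      MvPowerSeries.coeff Q (weighted 1 g * weighted 1 h) := by
  classical
  rw [coeff_weighted, MvPowerSeries.coeff_mul, MvPowerSeries.coeff_mul, Pi.one_apply, mul_one]
  refine (enorm_sum_le _ _).trans_eq (Finset.sum_congr rfl fun p _ => ?_)
  simp [coeff_weighted, enorm_mul]

theorem diagEval_mono {x : ℝ≥0∞} {f f' : MvPowerSeries (Fin n) ℝ≥0∞}
    (h : ∀ Q, MvPowerSeries.coeff Q f ≤ MvPowerSeries.coeff Q f') :
    diagEval x f ≤ diagEval x f' :=
  ENNReal.tsum_le_tsum fun Q => mul_le_mul_left (h Q) _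

theorem ConvergesAt.mul (hs : 0 ≤ s) (hg : ConvergesAt s g) (hh : ConvergesAt s h) :
    ConvergesAt s (g * h) := by
  rw [convergesAt_iff hs] at *
  refine ne_top_of_le_ne_top (ENNReal.mul_ne_top hg hh) ?_
  rw [← diagEval_mul]
  exact diagEval_mono coeff_weighted_mul_le

theorem mvSum_mul (hg : ConvergesAt s g) (hh : ConvergesAt s h) {z : V n} (hz : ‖z‖ ≤ s) :
    mvSum (g * h) z = mvSum g z * mvSum h z := by
  classical
  let a : (Fin n →₀ ℕ) → ℂ := fun Q => MvPowerSeries.coeff Q g * monom z Q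
  let b : (Fin n →₀ ℕ) → ℂ := fun Q => MvPowerSeries.coeff Q h * monom z Q
  have ha : Summable fun Q => ‖a Q‖ := hg.summable_norm hz
  have hb : Summable fun Q => ‖b Q‖ := hh.summable_norm hz
  have hmul := ha.of_norm.tsum_mul_tsum_eq_tsum_sum_antidiagonal hb.of_norm
    (summable_mul_of_summable_norm ha hb)
  refine Eq.trans (tsum_congr fun Q => ?_) hmul.symm
  rw [MvPowerSeries.coeff_mul, Finset.sum_mul]
  refine Finset.sum_congr rfl fun p hp => ?_
  rw [Finset.HasAntidiagonal.mem_antidiagonal] at hp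
  rw [← hp, monom_add]
  simp only [a, b]
  ring

theorem mvSum_one (z : V n) : mvSum 1 z = 1 := by
  classical
  unfold mvSum
  rw [tsum_eq_single 0]
  · simp [monom]
  · intro Q hQ
    simp [MvPowerSeries.coeff_one, hQ]

theorem convergesAt_one : ConvergesAt s (1 : MvPowerSeries (Fin n) ℂ) := by
  classical
  refine summable_of_ne_finset_zero (s := {0}) fun Q hQ => ?_
  simp [MvPowerSeries.coeff_one, Finset.mem_singleton.not.mp hQ]

theorem mvSum_prod {J : Type*} (t : Finset J) {g : J → MvPowerSeries (Fin n) ℂ} (hs : 0 ≤ s)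
    (hg : ∀ i, ConvergesAt s (g i)) {z : V n} (hz : ‖z‖ ≤ s) :
    ConvergesAt s (∏ i ∈ t, g i) ∧ mvSum (∏ i ∈ t, g i) z = ∏ i ∈ t, mvSum (g i) z := by
  classical
  induction t using Finset.induction_on with
  | empty => exact ⟨convergesAt_one, mvSum_one z⟩
  | insert a t ha ih =>
    rw [Finset.prod_insert ha, Finset.prod_insert ha]
    exact ⟨(hg a).mul hs ih.1, by rw [mvSum_mul (hg a) ih.1 hz, ih.2]⟩

theorem monom_eq_prod_factors (x : V n) (R : Fin n →₀ ℕ) :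
    monom x R = ∏ i : Factors R, x i.1 :=
  prod_pow_eq_prod_factors x R

theorem enorm_monom_le {z : V n} (hs : 0 ≤ s) (hz : ‖z‖ ≤ s) (Q : Fin n →₀ ℕ) :
    ‖monom z Q‖ₑ ≤ ENNReal.ofReal s ^ Q.degree := by
  rw [← ENNReal.ofReal_pow hs, ← ofReal_norm]
  exact ENNReal.ofReal_le_ofReal (norm_monom_le hz Q)

/-- Substitution of convergent power series is composition of their sums. -/
theorem mvSum_subst {T : MvPowerSeries (Fin n) ℂ} {g : Fin n → MvPowerSeries (Fin n) ℂ} {r : ℝ}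
    (hr : 0 ≤ r) (hT : ConvergesAt r T) (hs : 0 ≤ s) (hg : ∀ l, ConvergesAt s (g l))
    (hg0 : ∀ l, MvPowerSeries.constantCoeff (g l) = 0)
    (hgr : ∀ l, diagEval (ENNReal.ofReal s) (weighted 1 (g l)) ≤ ENNReal.ofReal r)
    {z : V n} (hz : ‖z‖ ≤ s) :
    mvSum (T.subst g) z = mvSum T fun l => mvSum (g l) z := by
  classical
  have hsub := MvPowerSeries.hasSubst_of_constantCoeff_zero hg0
  let f : (Fin n →₀ ℕ) → (Fin n →₀ ℕ) → ℂ := fun Q R =>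
    MvPowerSeries.coeff R T * (MvPowerSeries.coeff Q (∏ i : Factors R, g i.1) * monom z Q)
  -- Absolute summability over the pairs `(Q, R)` allows the exchange of sums. Summing over `Q`
  -- first, each factor contributes at most `r` by `hgr`, which leaves the absolute series of `T` at
  -- radius `r`.
  have hf : Summable (Function.uncurry f) := by
    suffices h : Summable fun p => ‖Function.uncurry f p‖₊ from
      Summable.of_norm (NNReal.summable_coe.mpr h)
    refine ENNReal.tsum_coe_ne_top_iff_summable.mp ?_
    rw [ENNReal.tsum_prod', ENNReal.tsum_comm]
    refine ne_top_of_le_ne_top ((convergesAt_iff hr).mp hT) (ENNReal.tsum_le_tsum fun R => ?_)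
    calc ∑' Q, ‖f Q R‖ₑ
        ≤ ∑' Q : Fin n →₀ ℕ, ‖MvPowerSeries.coeff R T‖ₑ *
          (MvPowerSeries.coeff Q (∏ i : Factors R, weighted 1 (g i.1)) *
            ENNReal.ofReal s ^ Q.degree) := by
          refine ENNReal.tsum_le_tsum fun Q => ?_
          simp only [f]
          rw [enorm_mul, enorm_mul]
          gcongr
          · exact enorm_coeff_prod_le (fun i : Factors R => g i.1) Q
          · exact enorm_monom_le hs hz Q
      _ = ‖MvPowerSeries.coeff R T‖ₑ *
          ∏ i : Factors R, diagEval (ENNReal.ofReal s) (weighted 1 (g i.1)) := by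
          rw [ENNReal.tsum_mul_left, ← diagEval_prod]
          rfl
      _ ≤ ‖MvPowerSeries.coeff R T‖ₑ * ∏ _i : Factors R, ENNReal.ofReal r := by
          gcongr
          exact hgr _
      _ = _ := by
          rw [Finset.prod_const, Finset.card_univ, card_factors, coeff_weighted, Pi.one_apply,
            mul_one]
  have hleft : ∀ Q, MvPowerSeries.coeff Q (T.subst g) * monom z Q = ∑' R, f Q R := by
    intro Q
    have hfin := MvPowerSeries.coeff_subst_finite hsub T Q
    rw [MvPowerSeries.coeff_subst hsub, ← tsum_eq_finsum (L := .unconditional _) hfin, ← tsum_mul_right]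
    refine tsum_congr fun R => ?_
    simp only [f]
    rw [finsuppProd_pow_eq_prod_factors, smul_eq_mul, mul_assoc]
  calc mvSum (T.subst g) z = ∑' Q, ∑' R, f Q R := tsum_congr hleft
    _ = ∑' R, ∑' Q, f Q R := hf.tsum_comm.symm
    _ = _ := by
      refine tsum_congr fun R => ?_
      simp only [f]
      rw [tsum_mul_left, monom_eq_prod_factors,
        ← (mvSum_prod Finset.univ (g := fun i : Factors R => g i.1) hs (fun i => hg i.1) hz).2]
      rfl

theorem mvSum_rescale (ν z : V n) : mvSum (MvPowerSeries.rescale ν g) z = mvSum g (ν * z) := by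
  refine tsum_congr fun Q => ?_
  rw [MvPowerSeries.coeff_rescale, Finsupp.prod_fintype _ _ (by simp)]
  simp only [monom, Pi.mul_apply, mul_pow, Finset.prod_mul_distrib]
  ring

theorem exists_multilinear_monom (d : ℕ) (Q : Fin n →₀ ℕ) (hQ : Q.degree = d) :
    ∃ L : ContinuousMultilinearMap ℂ (fun _ : Fin d => V n) ℂ,
      ‖L‖ ≤ 1 ∧ ∀ z, L (fun _ => z) = monom z Q := by
  have hcard : Fintype.card (Factors Q) = d := by rw [card_factors, hQ]
  let e := Fintype.equivFinOfCardEq hcard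
  refine ⟨(ContinuousMultilinearMap.mkPiAlgebra ℂ (Fin d) ℂ).compContinuousLinearMap
    fun i => ContinuousLinearMap.proj (e.symm i).1, ?_, fun z => ?_⟩
  · refine ContinuousMultilinearMap.opNorm_le_bound zero_le_one fun v => ?_
    simp only [ContinuousMultilinearMap.compContinuousLinearMap_apply,
      ContinuousMultilinearMap.mkPiAlgebra_apply, ContinuousLinearMap.proj_apply, one_mul]
    rw [norm_prod]
    exact Finset.prod_le_prod (fun _ _ => norm_nonneg _) fun i _ => norm_le_pi_norm (v i) _
  · simp only [ContinuousMultilinearMap.compContinuousLinearMap_apply,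
      ContinuousMultilinearMap.mkPiAlgebra_apply, ContinuousLinearMap.proj_apply]
    rw [monom_eq_prod_factors, e.symm.prod_comp fun i : Factors Q => z i.1]

/-- The monomials of each degree, realized by multilinear forms of norm at most one, are grouped
into one term. Absolute convergence gives both the radius and the regrouping. -/
theorem ConvergesAt.exists_hasFPowerSeriesAt (hg : ConvergesAt s g) (hs : 0 < s) :
    ∃ p : FormalMultilinearSeries ℂ (V n) ℂ, HasFPowerSeriesAt (mvSum g) p 0 ∧
      ∀ z, p 1 (fun _ => z) = ∑ l, MvPowerSeries.coeff (Finsupp.single l 1) g * z l := by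
  classical
  choose L hL hLz using fun (d : ℕ) (Q : {Q : Fin n →₀ ℕ // Q.degree = d}) =>
    exists_multilinear_monom d Q.1 Q.2
  have hfin : ∀ d : ℕ, Finite {Q : Fin n →₀ ℕ // Q.degree = d} := fun d =>
    (Finsupp.finite_of_degree_eq (σ := Fin n) d).to_subtype
  let _ : ∀ d : ℕ, Fintype {Q : Fin n →₀ ℕ // Q.degree = d} := fun d => Fintype.ofFinite _
  let p : FormalMultilinearSeries ℂ (V n) ℂ := fun d =>
    ∑ Q : {Q : Fin n →₀ ℕ // Q.degree = d}, MvPowerSeries.coeff Q.1 g • L d Q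
  have hp : ∀ d z, p d (fun _ => z) =
      ∑ Q : {Q : Fin n →₀ ℕ // Q.degree = d}, MvPowerSeries.coeff Q.1 g * monom z Q.1 := by
    intro d z
    simp only [p, _root_.sum_apply, _root_.smul_apply, hLz,
      smul_eq_mul]
  refine ⟨p, ⟨ENNReal.ofReal s, ?_, ?_, ?_⟩, fun z => ?_⟩
  · refine p.le_radius_of_bound (∑' Q : Fin n →₀ ℕ, ‖MvPowerSeries.coeff Q g‖ * s ^ Q.degree)
      fun d => ?_
    rw [Real.coe_toNNReal _ hs.le]
    calc ‖p d‖ * s ^ d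
        ≤ (∑ Q : {Q : Fin n →₀ ℕ // Q.degree = d}, ‖MvPowerSeries.coeff Q.1 g‖) * s ^ d := by
          refine mul_le_mul_of_nonneg_right (norm_sum_le_of_le _ fun Q _ => ?_) (by positivity)
          rw [norm_smul]
          exact mul_le_of_le_one_right (norm_nonneg _) (hL d Q)
      _ = ∑ Q : {Q : Fin n →₀ ℕ // Q.degree = d},
            ‖MvPowerSeries.coeff Q.1 g‖ * s ^ Q.1.degree := by
          rw [Finset.sum_mul]
          exact Finset.sum_congr rfl fun Q _ => by rw [Q.2]
      _ ≤ _ := by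
          rw [← tsum_fintype (L := .unconditional _)]
          exact tsum_comp_le_tsum_of_inj hg (fun Q => by positivity) Subtype.val_injective
  · simpa using hs
  · intro y hy
    have hy' : ‖y‖ ≤ s := by
      rw [Metric.mem_eball, edist_zero_right, ← ofReal_norm] at hy
      exact ((ENNReal.ofReal_lt_ofReal_iff hs).mp hy).le
    have h1 := (Equiv.sigmaFiberEquiv fun Q : Fin n →₀ ℕ => Q.degree).hasSum_iff.mpr
      (hg.hasSum hy')
    rw [zero_add]
    refine h1.sigma fun d => ?_
    rw [hp]
    exact hasSum_fintype _
  · rw [hp]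
    have hbij : Function.Bijective fun l : Fin n =>
        (⟨Finsupp.single l 1, Finsupp.degree_single _ _⟩ :
          {Q : Fin n →₀ ℕ // Q.degree = 1}) := by
      refine ⟨fun l l' hl => ?_, fun Q => ?_⟩
      · exact Finsupp.single_left_injective one_ne_zero (congrArg Subtype.val hl)
      · rcases degree_lt_two_cases (Q := Q.1) (by rw [Q.2]; norm_num) with h0 | ⟨l, hl⟩
        · have := Q.2
          simp [h0] at this
        · exact ⟨l, Subtype.ext hl.symm⟩
    refine (Fintype.sum_bijective _ hbij _ _ fun l => ?_).symm
    rw [monom_single]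

theorem IsTangentToId.hasFDerivAt {g : Fin n → MvPowerSeries (Fin n) ℂ} (hg : IsTangentToId g)
    (hs : 0 < s) (hgs : ∀ k, ConvergesAt s (g k)) :
    AnalyticAt ℂ (fun z k => mvSum (g k) z) 0 ∧
      HasFDerivAt (fun z k => mvSum (g k) z) (ContinuousLinearMap.id ℂ (V n)) 0 := by
  choose p hp hp1 using fun k => (hgs k).exists_hasFPowerSeriesAt hs
  refine ⟨AnalyticAt.pi fun k => (hp k).analyticAt, ?_⟩
  rw [hasFDerivAt_pi']
  intro k
  convert (hp k).hasFDerivAt using 1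
  ext z
  rw [continuousMultilinearCurryFin1_apply]
  have h1 := hp1 k z
  simp only [hg.coeff_single] at h1
  simp only [ContinuousLinearMap.comp_apply, ContinuousLinearMap.proj_apply,
    ContinuousLinearMap.id_apply]
  have h2 : (Fin.snoc 0 z : Fin 1 → V n) = fun _ => z := by
    funext i
    obtain rfl : i = Fin.last 0 := Subsingleton.elim (α := Fin 1) _ _
    simp
  rw [h2, h1]
  simp

theorem mvSum_zero (g : MvPowerSeries (Fin n) ℂ) :
    mvSum g 0 = MvPowerSeries.constantCoeff g := by
  unfold mvSum
  rw [tsum_eq_single 0]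
  · simp [monom]
  · intro Q hQ
    obtain ⟨l, hl⟩ := Finsupp.ne_iff.mp hQ
    have : monom (0 : V n) Q = 0 :=
      Finset.prod_eq_zero (Finset.mem_univ l) (zero_pow hl)
    rw [this, mul_zero]

/-- Convergence persists on smaller polydiscs, where series without constant term are small. -/
theorem exists_diagEval_le {g : Fin n → MvPowerSeries (Fin n) ℂ} (hs : 0 < s)
    (hg : ∀ l, ConvergesAt s (g l)) (hg0 : ∀ l, MvPowerSeries.constantCoeff (g l) = 0)
    {r : ℝ} (hr : 0 < r) :
    ∃ t, 0 < t ∧ ∀ l, ConvergesAt t (g l) ∧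
      diagEval (ENNReal.ofReal t) (weighted 1 (g l)) ≤ ENNReal.ofReal r := by
  let K : ℝ := ∑ l, (diagEval (ENNReal.ofReal s) (weighted 1 (g l))).toReal
  have hK0 : 0 ≤ K := Finset.sum_nonneg fun l _ => ENNReal.toReal_nonneg
  have hK : ∀ l, diagEval (ENNReal.ofReal s) (weighted 1 (g l)) ≤ ENNReal.ofReal K := by
    intro l
    rw [← ENNReal.ofReal_toReal ((convergesAt_iff hs.le).mp (hg l))]
    exact ENNReal.ofReal_le_ofReal (Finset.single_le_sum
      (f := fun l => (diagEval (ENNReal.ofReal s) (weighted 1 (g l))).toReal)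
      (fun l _ => ENNReal.toReal_nonneg) (Finset.mem_univ l))
  -- Shrinking the radius by `c ≤ 1` multiplies every term of positive degree by at most `c`, and
  -- there is no constant term.
  let c : ℝ := min 1 (r / (K + 1))
  have hc : 0 < c := lt_min one_pos (by positivity)
  have hcK : c * K ≤ r := by
    have h1 : c * (K + 1) ≤ r := (le_div_iff₀ (by positivity)).mp (min_le_right _ _)
    nlinarith
  have hle : ∀ l, diagEval (ENNReal.ofReal (c * s)) (weighted 1 (g l)) ≤ ENNReal.ofReal r := by
    intro l
    calc _ ≤ ENNReal.ofReal c * diagEval (ENNReal.ofReal s) (weighted 1 (g l)) := by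
          unfold diagEval
          rw [← ENNReal.tsum_mul_left]
          refine ENNReal.tsum_le_tsum fun Q => ?_
          by_cases hQ : Q = 0
          · rw [hQ, coeff_weighted, MvPowerSeries.coeff_zero_eq_constantCoeff_apply, hg0]
            simp
          · have hd : Q.degree ≠ 0 := by rwa [Ne, Finsupp.degree_eq_zero_iff]
            have hc1 : ENNReal.ofReal c ≤ 1 := by
              rw [← ENNReal.ofReal_one]
              exact ENNReal.ofReal_le_ofReal (min_le_left _ _)
            rw [ENNReal.ofReal_mul hc.le, mul_pow, mul_left_comm]
            gcongr
            exact pow_le_of_le_one zero_le hc1 hd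
      _ ≤ ENNReal.ofReal c * ENNReal.ofReal K := by
          gcongr
          exact hK l
      _ ≤ ENNReal.ofReal r := by
          rw [← ENNReal.ofReal_mul hc.le]
          exact ENNReal.ofReal_le_ofReal hcK
  exact ⟨c * s, mul_pos hc hs, fun l => ⟨(convergesAt_iff (mul_pos hc hs).le).mpr
    (ne_top_of_le_ne_top ENNReal.ofReal_ne_top (hle l)), hle l⟩⟩

/-- The series with conjugated coefficients. -/
noncomputable def conjSeries (g : MvPowerSeries (Fin n) ℂ) : MvPowerSeries (Fin n) ℂ :=
  fun Q => star (MvPowerSeries.coeff Q g)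

theorem coeff_conjSeries (g : MvPowerSeries (Fin n) ℂ) (Q : Fin n →₀ ℕ) :
    MvPowerSeries.coeff Q (conjSeries g) = star (MvPowerSeries.coeff Q g) := rfl

theorem ConvergesAt.conjSeries (hg : ConvergesAt s g) : ConvergesAt s (conjSeries g) := by
  simpa only [ConvergesAt, coeff_conjSeries, norm_star] using hg

theorem IsTangentToId.conjSeries {g : Fin n → MvPowerSeries (Fin n) ℂ} (hg : IsTangentToId g) :
    IsTangentToId fun k => conjSeries (g k) where
  constantCoeff_eq_zero k := by
    rw [← MvPowerSeries.coeff_zero_eq_constantCoeff_apply, coeff_conjSeries,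
      MvPowerSeries.coeff_zero_eq_constantCoeff_apply, hg.constantCoeff_eq_zero, star_zero]
  coeff_single k l := by
    rw [coeff_conjSeries, hg.coeff_single]
    split_ifs <;> simp

theorem star_monom (z : V n) (Q : Fin n →₀ ℕ) : star (monom z Q) = monom (star z) Q := by
  simp [monom]

theorem mvSum_conjSeries (g : MvPowerSeries (Fin n) ℂ) (z : V n) : mvSum (conjSeries g) (star z) = star (mvSum g z) := by
  unfold mvSum
  rw [tsum_star]
  refine tsum_congr fun Q => ?_
  rw [coeff_conjSeries, star_mul', star_monom]

end ConvergentSeries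

/-! ### Convergence of Taylor expansions -/

section TaylorSeries

variable {n : ℕ}

/-- At a point with all coordinates equal to `ε / 2` each monomial is `(ε / 2) ^ Q.degree`, and
unconditional convergence in `ℂ` is absolute. -/
theorem HasTaylorSeries.exists_convergesAt {ι : Type*} [Finite ι] {F : ι → V n → V n}
    {T : ι → Fin n → MvPowerSeries (Fin n) ℂ} (h : ∀ a, HasTaylorSeries (F a) (T a)) :
    ∃ r : ℝ, 0 < r ∧ ∀ a k, ConvergesAt r (T a k) := by
  obtain ⟨ε, hε, hball⟩ := Metric.eventually_nhds_iff_ball.mp (eventually_all.mpr h)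
  refine ⟨ε / 2, by positivity, fun a k => ?_⟩
  have hmem : (fun _ => ((ε / 2 : ℝ) : ℂ) : V n) ∈ Metric.ball 0 ε := by
    rw [mem_ball_zero_iff, pi_norm_lt_iff hε]
    intro _
    rw [Complex.norm_real, Real.norm_of_nonneg (by positivity)]
    linarith
  refine (hball _ hmem a k).summable.norm.congr fun Q => ?_
  rw [monom_const, norm_mul, norm_pow, Complex.norm_real, Real.norm_of_nonneg (by positivity)]

theorem HasTaylorSeries.eventually_eq {F : V n → V n} {T : Fin n → MvPowerSeries (Fin n) ℂ}
    (h : HasTaylorSeries F T) : ∀ᶠ z in 𝓝 (0 : V n), F z = fun k => mvSum (T k) z :=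
  h.mono fun _ hz => funext fun k => (hz k).tsum_eq.symm

theorem HasTaylorSeries.constantCoeff_eq {F : V n → V n} {T : Fin n → MvPowerSeries (Fin n) ℂ}
    (h : HasTaylorSeries F T) (k : Fin n) : MvPowerSeries.constantCoeff (T k) = F 0 k := by
  rw [← mvSum_zero, h.eventually_eq.self_of_nhds]

end TaylorSeries

/-! ### Linear parts of compositions of antiholomorphic germs -/

section LinearParts

variable {n : ℕ}

theorem fderiv_eq_mulVec {f : V n → V n} (v : V n) :
    fderiv ℂ f 0 v =
      (LinearMap.toMatrix' (fderiv ℂ f 0 : V n →ₗ[ℂ] V n)).mulVec v := by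
  rw [LinearMap.toMatrix'_mulVec]
  rfl

/-- `ρ` is the composition of a holomorphic germ fixing `0` with the conjugation. -/
structure IsAntiholomorphicGerm (ρ : V n → V n) : Prop where
  analyticAt : AnalyticAt ℂ (fun w => ρ (star w)) 0
  map_zero : ρ 0 = 0

variable {ρ ρ' : V n → V n}

theorem IsAntiholomorphicGerm.hasFDerivAt (hρ : IsAntiholomorphicGerm ρ) :
    HasFDerivAt (fun w => ρ (star w)) (fderiv ℂ (fun w => ρ (star w)) 0) 0 :=
  hρ.analyticAt.differentiableAt.hasFDerivAt

theorem IsAntiholomorphicGerm.tendsto (hρ : IsAntiholomorphicGerm ρ) :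
    Tendsto ρ (𝓝 0) (𝓝 0) := by
  have h1 : Tendsto (fun w => ρ (star w)) (𝓝 0) (𝓝 0) := by
    have := hρ.analyticAt.continuousAt.tendsto
    rwa [star_zero, hρ.map_zero] at this
  have h2 : Tendsto (star : V n → V n) (𝓝 0) (𝓝 0) := by
    have := (continuous_star (R := V n)).tendsto 0
    rwa [star_zero] at this
  have := h1.comp h2
  simpa only [Function.comp_def, star_star] using this

/-- Conjugations inserted between the two germs make both factors holomorphic, so the complex chain
rule applies. The second derivative matrix comes out conjugated. -/
theorem linearPart_comp (hρ : IsAntiholomorphicGerm ρ) (hρ' : IsAntiholomorphicGerm ρ') :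
    linearPart (ρ ∘ ρ') = antilinearPart ρ * (antilinearPart ρ').map star := by
  have h2 := hρ'.hasFDerivAt.star_star
  rw [star_zero] at h2
  have h0 : (star ∘ (fun w => ρ' (star w)) ∘ star) (0 : V n) = 0 := by
    simp [hρ'.map_zero]
  have h1 := hρ.hasFDerivAt
  rw [← h0] at h1
  have h3 := h1.comp (0 : V n) h2
  have heq : (fun w => ρ (star w)) ∘ (star ∘ (fun w => ρ' (star w)) ∘ star) = ρ ∘ ρ' := by
    funext z
    simp
  rw [heq, h0] at h3
  ext k l
  unfold linearPart
  rw [h3.fderiv, LinearMap.toMatrix'_apply, Matrix.mul_apply]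
  have h4 : ∀ v : V n, star (fderiv ℂ (fun w => ρ' (star w)) 0 (star v)) =
      ((antilinearPart ρ').map star).mulVec v := by
    intro v
    rw [fderiv_eq_mulVec]
    change star ((antilinearPart ρ').mulVec (star v)) = _
    funext i
    simp [Matrix.mulVec, dotProduct]
  change fderiv ℂ (fun w => ρ (star w)) 0
    (star (fderiv ℂ (fun w => ρ' (star w)) 0 (star (Pi.single l 1 : V n)))) k = _
  rw [h4, fderiv_eq_mulVec]
  change (antilinearPart ρ).mulVec _ k = _
  simp [Matrix.mulVec, dotProduct, Pi.single_apply]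

theorem linearPart_congr {f g : V n → V n} (h : f =ᶠ[𝓝 0] g) : linearPart f = linearPart g := by
  unfold linearPart
  rw [h.fderiv_eq]

theorem linearPart_id : linearPart (id : V n → V n) = 1 := by
  unfold linearPart
  rw [fderiv_id]
  exact LinearMap.toMatrix'_id

end LinearParts

/-! ### Relations between the multipliers, and absence of resonances -/

section Relations

variable {n m : ℕ} {B : Fin m → Matrix (Fin n) (Fin n) ℂ} {μ : Fin m → Fin m → V n}

/-- By `hB`, `D_{i,j} D_{j,i} = 1`, and both `B i * conj D_{i,j}` and `D_{j,i} * B i` collapse to `B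
j`. -/
theorem diagonal_relations (hB : ∀ i, B i * (B i).map star = 1)
    (hdiag : ∀ i j, B i * (B j).map star = Matrix.diagonal (μ i j)) :
    (∀ i j k, μ i j k * μ j i k = 1) ∧
      ∀ i j k l, B i k l * star (μ i j l) = μ j i k * B i k l := by
  have hB' : ∀ i, (B i).map star * B i = 1 := fun i => mul_eq_one_comm.mp (hB i)
  have hinv : ∀ i j, Matrix.diagonal (μ i j) * Matrix.diagonal (μ j i) = 1 := by
    intro i j
    rw [← hdiag, ← hdiag, mul_assoc, ← mul_assoc ((B j).map star), hB', one_mul, hB]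
  have hconj : ∀ i j, B i * Matrix.diagonal (star (μ i j)) = Matrix.diagonal (μ j i) * B i := by
    intro i j
    have h1 : Matrix.diagonal (star (μ i j)) = (B i).map star * B j := by
      have h2 : Matrix.diagonal (star (μ i j)) = (Matrix.diagonal (μ i j)).map star := by
        rw [Matrix.diagonal_map (star_zero ℂ)]
        rfl
      rw [h2, ← hdiag]
      ext k l
      simp [Matrix.mul_apply]
    rw [h1, ← mul_assoc, hB, one_mul, ← hdiag, mul_assoc, hB', mul_one]
  refine ⟨fun i j k => ?_, fun i j k l => ?_⟩
  · have h := congrFun (congrFun (hinv i j) k) k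
    simpa [Matrix.diagonal_mul_diagonal] using h
  · have h := congrFun (congrFun (hconj i j) k) l
    simpa [Matrix.mul_diagonal, Matrix.diagonal_mul] using h

theorem IsNonResonant.hasNoResonance [Nonempty (Fin m)] (hB : ∀ i, B i * (B i).map star = 1)
    (hdiag : ∀ i j, B i * (B j).map star = Matrix.diagonal (μ i j)) (hμ : IsNonResonant μ) :
    HasNoResonance fun p : Fin m × Fin m => μ p.1 p.2 := by
  obtain ⟨hinv, hconj⟩ := diagonal_relations hB hdiag
  intro Q k hQ
  by_contra! hres
  obtain ⟨i⟩ := ‹Nonempty (Fin m)›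
  -- `B i` need not be diagonal. A nonzero entry in column `k` gives `conj μ_{i,j,k} = μ_{j,i,k'}`
  -- for all `j`, so a resonance at `k` becomes a forbidden one at `k'`.
  obtain ⟨k', hk'⟩ : ∃ k', B i k' k ≠ 0 := by
    by_contra! h0
    have hB' : (B i).map star * B i = 1 := mul_eq_one_comm.mp (hB i)
    have h1 := congrFun (congrFun hB' k) k
    rw [Matrix.mul_apply, Finset.sum_eq_zero fun x _ => by rw [h0, mul_zero]] at h1
    simp at h1
  obtain ⟨j, hj⟩ := hμ i k' Q hQ
  refine hj ?_
  have h2 := hconj i j k' k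
  rw [mul_comm] at h2
  rw [← star_monom, hres (i, j), mul_right_cancel₀ hk' h2]
  exact eq_inv_of_mul_eq_one_right (hinv i j k')

end Relations

/-! ### The linear models are totally real -/

section TotallyReal

variable {n : ℕ} {B : Matrix (Fin n) (Fin n) ℂ}

/-- The antilinear involution splits `ℂⁿ` into its `+1` and `-1` eigenspaces, and `I` exchanges
them. Hence `(a, b) ↦ a + I • b` is a real isomorphism from two copies of the fixed space, whose
dimension is half of `2 * n`. -/
theorem isTotallyReal_fixedSubspace (hB : B * B.map star = 1) :
    IsTotallyReal (fixedSubspace B) := by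
  have hmem : ∀ z, z ∈ fixedSubspace B ↔ B.mulVec (star z) = z := fun z => Iff.rfl
  have hI : ∀ z : V n, B.mulVec (star (Complex.I • z)) = -(Complex.I • B.mulVec (star z)) := by
    intro z
    rw [star_smul, Matrix.mulVec_smul]
    simp
  have hinv : ∀ z : V n, B.mulVec (star (B.mulVec (star z))) = z := by
    intro z
    have h1 : star (B.mulVec (star z)) = (B.map star).mulVec z := by
      funext k
      simp [Matrix.mulVec, dotProduct]
    rw [h1, Matrix.mulVec_mulVec, hB, Matrix.one_mulVec]
  have hreal : ∀ z ∈ fixedSubspace B, Complex.I • z ∈ fixedSubspace B → z = 0 := by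
    intro z hz hIz
    rw [hmem, hI, (hmem z).mp hz, neg_eq_iff_add_eq_zero, ← two_smul ℂ, smul_smul] at hIz
    exact (smul_eq_zero.mp hIz).resolve_left (by simp)
  refine ⟨?_, hreal⟩
  let f : fixedSubspace B × fixedSubspace B →ₗ[ℝ] V n :=
    { toFun := fun p => p.1.1 + Complex.I • p.2.1
      map_add' := fun p q => by
        simp only [Prod.fst_add, Prod.snd_add, Submodule.coe_add, smul_add]
        abel
      map_smul' := fun c p => by
        simp only [Prod.smul_fst, Prod.smul_snd, Submodule.coe_smul, RingHom.id_apply, smul_add]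
        rw [smul_comm c Complex.I] }
  have hf : Function.Bijective f := by
    constructor
    · rw [← LinearMap.ker_eq_bot, LinearMap.ker_eq_bot']
      rintro ⟨⟨a, ha⟩, ⟨b, hb⟩⟩ hab
      have hab' : a + Complex.I • b = 0 := hab
      have hbI : Complex.I • b ∈ fixedSubspace B := by
        rw [eq_neg_of_add_eq_zero_right hab']
        exact (fixedSubspace B).neg_mem ha
      have hb0 : b = 0 := hreal b hb hbI
      subst hb0
      rw [smul_zero, add_zero] at hab'
      subst hab'
      rfl
    · intro z
      refine ⟨(⟨(2⁻¹ : ℝ) • (z + B.mulVec (star z)), Submodule.smul_mem _ _ ?_⟩,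
        ⟨(2⁻¹ : ℝ) • (Complex.I • (B.mulVec (star z) - z)), Submodule.smul_mem _ _ ?_⟩), ?_⟩
      · rw [hmem, star_add, Matrix.mulVec_add, hinv, add_comm]
      · rw [hmem, hI, star_sub, Matrix.mulVec_sub, hinv, ← smul_neg, neg_sub]
      · change (2⁻¹ : ℝ) • (z + B.mulVec (star z)) +
          Complex.I • ((2⁻¹ : ℝ) • (Complex.I • (B.mulVec (star z) - z))) = z
        rw [smul_comm Complex.I, smul_smul Complex.I, Complex.I_mul_I, neg_one_smul, ← smul_add,
          neg_sub, add_add_sub_cancel, ← two_smul ℝ, smul_smul]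
        norm_num
  have h1 := (LinearEquiv.ofBijective f hf).finrank_eq
  rw [Module.finrank_prod, Module.finrank_pi_fintype] at h1
  simp only [Complex.finrank_real_complex, Finset.sum_const, Finset.card_univ, Fintype.card_fin,
    smul_eq_mul] at h1
  omega

end TotallyReal

/-! ### Holomorphic local inverses -/

section LocalInverse

theorem exists_analytic_inverse {n : ℕ} {f : V n → V n} (hf : AnalyticAt ℂ f 0) (h0 : f 0 = 0)
    (hf' : HasFDerivAt f (ContinuousLinearMap.id ℂ (V n)) 0) :
    ∃ g : V n → V n, AnalyticAt ℂ g 0 ∧ g 0 = 0 ∧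
      HasFDerivAt g (ContinuousLinearMap.id ℂ (V n)) 0 ∧
      (∀ᶠ z in 𝓝 0, g (f z) = z) ∧ ∀ᶠ z in 𝓝 0, f (g z) = z := by
  have hfe : HasFDerivAt f ((ContinuousLinearEquiv.refl ℂ (V n) : V n ≃L[ℂ] V n) :
      V n →L[ℂ] V n) 0 := hf'
  have hc : ContDiffAt ℂ ⊤ f 0 := hf.contDiffAt
  have hs := hc.hasStrictFDerivAt' hfe (by simp)
  have hg := hc.to_localInverse hfe (by simp)
  have hr := hs.eventually_right_inverse
  have hd := hs.to_localInverse.hasFDerivAt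
  have hz := hs.localInverse_apply_image
  rw [h0] at hg hr hd hz
  exact ⟨_, hg.analyticAt, hz, hd, hs.eventually_left_inverse, hr⟩

end LocalInverse

/-! ### Germs intertwining diagonal maps -/

section Centralizer

variable {n : ℕ}

/-- Multiplication by a vector, as a continuous linear map. -/
noncomputable def mulCLM (α : V n) : V n →L[ℂ] V n :=
  ContinuousLinearMap.pi fun k => α k • ContinuousLinearMap.proj k

theorem monom_sum {d : ℕ} (α : V n) (v : Fin d → Fin n) :
    monom α (∑ i, Finsupp.single (v i) 1) = ∏ i, α (v i) := by
  simp only [← monom_single]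
  induction (Finset.univ : Finset (Fin d)) using Finset.induction_on with
  | empty => simp [monom]
  | insert a s ha ih => rw [Finset.sum_insert ha, Finset.prod_insert ha, monom_add, ih]

theorem iteratedFDeriv_mul_eq {H : V n → V n} (hH : AnalyticAt ℂ H 0) {α β : V n}
    (hαβ : ∀ᶠ w in 𝓝 (0 : V n), H (α * w) = β * H w) (d : ℕ) (v : Fin d → V n) :
    iteratedFDeriv ℂ d H 0 (fun i => α * v i) = β * iteratedFDeriv ℂ d H 0 v := by
  obtain ⟨r, hr, hball⟩ := hH.exists_ball_analyticOnNhd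
  have hopen : IsOpen (mulCLM α ⁻¹' Metric.ball (0 : V n) r) :=
    Metric.isOpen_ball.preimage (mulCLM α).continuous
  have hα0 : mulCLM α 0 ∈ Metric.ball (0 : V n) r := by simpa using hr
  have h1 := (mulCLM α).iteratedFDerivWithin_comp_right (n := ⊤) (x := 0) (i := d)
    (hball.contDiffOn Metric.isOpen_ball.uniqueDiffOn) Metric.isOpen_ball.uniqueDiffOn hopen.uniqueDiffOn hα0 le_top
  rw [iteratedFDerivWithin_of_isOpen d hopen hα0,
    iteratedFDerivWithin_of_isOpen d Metric.isOpen_ball hα0, map_zero] at h1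
  have h2 := (mulCLM β).iteratedFDeriv_comp_left (n := ⊤) (i := d) hH.contDiffAt le_top
  have h3 : H ∘ mulCLM α =ᶠ[𝓝 0] mulCLM β ∘ H := hαβ
  have h4 := (h3.iteratedFDeriv ℂ d).self_of_nhds
  rw [h1, h2] at h4
  exact congrArg (fun L => L v) h4

/-- A holomorphic germ intertwining non-resonant diagonal families is linear. -/
theorem eventually_eq_fderiv_of_nonresonant {ι : Type*} {H : V n → V n} (hH : AnalyticAt ℂ H 0)
    (h0 : H 0 = 0) {α β : ι → V n}
    (hαβ : ∀ j, ∀ᶠ w in 𝓝 (0 : V n), H (α j * w) = β j * H w)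
    (hres : ∀ (k : Fin n) (Q : Fin n →₀ ℕ), 2 ≤ Q.degree → ∃ j, monom (α j) Q ≠ β j k) :
    ∀ᶠ w in 𝓝 (0 : V n), H w = fderiv ℂ H 0 w := by
  have hzero : ∀ d, 2 ≤ d → iteratedFDeriv ℂ d H 0 = 0 := by
    intro d hd
    refine ContinuousMultilinearMap.toMultilinearMap_injective ?_
    -- On basis vectors the intertwining relation multiplies component `k` of the derivative by `α j
    -- ^ Q - β j k`, with `Q` counting the chosen indices. A suitable `j` makes this factor nonzero.
    refine Module.Basis.ext_multilinear (fun _ => Pi.basisFun ℂ (Fin n)) fun v => ?_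
    funext k
    simp only [Pi.basisFun_apply]
    have hQ : (∑ i, Finsupp.single (v i) 1 : Fin n →₀ ℕ).degree = d := by
      rw [map_sum]
      simp
    obtain ⟨j, hj⟩ := hres k (∑ i, Finsupp.single (v i) 1) (by omega)
    have h1 := iteratedFDeriv_mul_eq hH (hαβ j) d fun i => Pi.single (v i) 1
    have h2 : ∀ i, α j * (Pi.single (v i) 1 : V n) = α j (v i) • (Pi.single (v i) 1 : V n) := by
      intro i
      ext l
      by_cases hl : l = v i
      · subst hl
        simp
      · simp [hl]
    simp only [h2] at h1
    rw [ContinuousMultilinearMap.map_smul_univ, ← monom_sum] at h1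
    have h3 := congrFun h1 k
    rw [Pi.smul_apply, Pi.mul_apply, smul_eq_mul, ← sub_eq_zero, ← sub_mul] at h3
    exact (mul_eq_zero.mp h3).resolve_left (sub_ne_zero.mpr hj)
  obtain ⟨p, r, hp⟩ := hH
  filter_upwards [Metric.eball_mem_nhds (0 : V n) hp.r_pos] with w hw
  have h1 := hp.hasSum_iteratedFDeriv hw
  rw [zero_add] at h1
  refine h1.unique ?_
  convert hasSum_single 1 fun d hd => ?_ using 1
  · simp [iteratedFDeriv_one_apply]
  · rcases Nat.lt_or_ge d 1 with h | h
    · obtain rfl : d = 0 := by omega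
      simp [h0]
    · rw [hzero d (by omega)]
      simp

end Centralizer

/-! ### Convergent linearization of the family of compositions -/

section Linearization

variable {n : ℕ}

/-- A diophantine non-resonant family of germs that is formally linearizable is linearized by a
convergent power series. -/
theorem exists_convergent_linearization {ι : Type*} [Fintype ι] [Nonempty ι] {μ : ι → V n}
    (h : HasNoResonance μ) (hμ : ∀ a k, μ a k ≠ 0) (hdioph : IsDiophantine μ)
    {F : ι → V n → V n} {T : ι → Fin n → MvPowerSeries (Fin n) ℂ}
    (hFT : ∀ a, HasTaylorSeries (F a) (T a)) (hF0 : ∀ a, F a 0 = 0)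
    {A : Fin n → MvPowerSeries (Fin n) ℂ} (hA : IsTangentToId A)
    (hAT : ∀ a k, (A k).subst (T a) = μ a k • A k) :
    ∃ (g : Fin n → MvPowerSeries (Fin n) ℂ) (s : ℝ), IsTangentToId g ∧ 0 < s ∧
      (∀ k, ConvergesAt s (g k)) ∧ ∀ a, ∀ᶠ z in 𝓝 (0 : V n),
        F a (fun k => mvSum (g k) z) = fun k => mvSum (g k) (μ a * z) := by
  obtain ⟨g, hg, hAg, hgA⟩ := hA.exists_inverse
  have hT0 : ∀ a k, MvPowerSeries.constantCoeff (T a k) = 0 := by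
    intro a k
    rw [(hFT a).constantCoeff_eq, hF0, Pi.zero_apply]
  have hT1 : ∀ a k l, MvPowerSeries.coeff (Finsupp.single l 1) (T a k) =
      if l = k then μ a k else 0 := by
    intro a k l
    rw [coeff_single_of_subst_eq (L := Matrix.diagonal (μ a)) hA (hT0 a) (fun k => ?_),
      Matrix.diagonal_apply]
    · simp only [eq_comm]
    · rw [hAT, Finset.sum_eq_single k]
      · rw [Matrix.diagonal_apply_eq]
      · intro b _ hb
        rw [Matrix.diagonal_apply_ne _ hb.symm, zero_smul]
      · simp
  have hT : ∀ a k, (T a k).subst g = MvPowerSeries.rescale (μ a) (g k) := fun a k =>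
    subst_inverse_eq_rescale hA hg hAg hgA (hT0 a) (hAT a) k
  obtain ⟨r, hr, hTr⟩ := HasTaylorSeries.exists_convergesAt hFT
  obtain ⟨s, hs, hgs⟩ := exists_summable_of_isDiophantine h hμ hdioph hg hT0 hT1 hT hr hTr
  -- A smaller polydisc, on which `g` stays within the polydisc of convergence of the `T a`, so that
  -- formal substitution is true composition.
  obtain ⟨t, ht, hgt⟩ := exists_diagEval_le hs hgs hg.constantCoeff_eq_zero hr
  refine ⟨g, s, hg, hs, hgs, fun a => ?_⟩
  have hcont : Tendsto (fun z k => mvSum (g k) z) (𝓝 (0 : V n)) (𝓝 0) := by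
    have h1 := (hg.hasFDerivAt hs hgs).1.continuousAt.tendsto
    have h2 : (fun k => mvSum (g k) (0 : V n)) = 0 := by
      funext k
      rw [mvSum_zero, hg.constantCoeff_eq_zero, Pi.zero_apply]
    rwa [h2] at h1
  filter_upwards [hcont.eventually (hFT a).eventually_eq,
    Metric.closedBall_mem_nhds (0 : V n) ht] with z hz hzt
  rw [mem_closedBall_zero_iff] at hzt
  rw [hz]
  funext k
  rw [← mvSum_subst hr.le (hTr a k) ht.le (fun l => (hgt l).1) hg.constantCoeff_eq_zero
    (fun l => (hgt l).2) hzt, hT, mvSum_rescale]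

theorem IsInvolutionOf.isAntiholomorphicGerm {M : Set (V n)} {ρ : V n → V n}
    (h : IsInvolutionOf M ρ) : IsAntiholomorphicGerm ρ :=
  ⟨h.antiholomorphic, h.map_zero⟩

theorem IsInvolutionOf.antilinearPart_mul {M : Set (V n)} {ρ : V n → V n}
    (h : IsInvolutionOf M ρ) : antilinearPart ρ * (antilinearPart ρ).map star = 1 := by
  rw [← linearPart_comp h.isAntiholomorphicGerm h.isAntiholomorphicGerm, ← linearPart_id]
  exact linearPart_congr h.involutive

end Linearization

/-! ### From linearized compositions to linearized involutions -/

section Conjugation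

variable {n m : ℕ} {ρ : Fin m → V n → V n} {μ : Fin m → Fin m → V n}

/-- A linearization of all the compositions `ρ i ∘ ρ j` of a non-resonant family linearizes the
involutions themselves. -/
theorem eventually_conj_eq_mulVec (hρ : ∀ i, IsAntiholomorphicGerm (ρ i))
    (hinvol : ∀ i, ∀ᶠ z in 𝓝 (0 : V n), ρ i (ρ i z) = z)
    (hμinv : ∀ i j k, μ i j k * μ j i k = 1) (hnonres : IsNonResonant μ)
    {g : Fin n → MvPowerSeries (Fin n) ℂ} {s : ℝ} (hg : IsTangentToId g) (hs : 0 < s)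
    (hgs : ∀ k, ConvergesAt s (g k))
    (hconj : ∀ i j, ∀ᶠ z in 𝓝 (0 : V n),
      ρ i (ρ j fun k => mvSum (g k) z) = fun k => mvSum (g k) (μ i j * z))
    {Φ : V n → V n} (hΦ : AnalyticAt ℂ Φ 0) (hΦ0 : Φ 0 = 0)
    (hΦ' : HasFDerivAt Φ (ContinuousLinearMap.id ℂ (V n)) 0)
    (hleft : ∀ᶠ z in 𝓝 (0 : V n), Φ (fun k => mvSum (g k) z) = z)
    (hright : ∀ᶠ z in 𝓝 (0 : V n), (fun k => mvSum (g k) (Φ z)) = z) (i : Fin m) :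
    ∀ᶠ z in 𝓝 (0 : V n), Φ (ρ i z) = (antilinearPart (ρ i)).mulVec (star (Φ z)) := by
  let Ψ : V n → V n := fun z k => mvSum (g k) z
  let Ψ' : V n → V n := fun z k => mvSum (conjSeries (g k)) z
  have hΨ0 : Ψ 0 = 0 := by
    funext k
    simp only [Ψ, mvSum_zero, hg.constantCoeff_eq_zero, Pi.zero_apply]
  have hΨ'0 : Ψ' 0 = 0 := by
    funext k
    simp only [Ψ', mvSum_zero, hg.conjSeries.constantCoeff_eq_zero, Pi.zero_apply]
  have hΨan := hg.hasFDerivAt hs hgs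
  have hΨ'an := hg.conjSeries.hasFDerivAt hs fun k => (hgs k).conjSeries
  have hΨ't : Tendsto Ψ (𝓝 0) (𝓝 0) := by
    have := hΨan.1.continuousAt.tendsto
    rwa [show (fun k => mvSum (g k) (0 : V n)) = 0 from hΨ0] at this
  have hΦt : Tendsto Φ (𝓝 0) (𝓝 0) := by
    have := hΦ.continuousAt.tendsto
    rwa [hΦ0] at this
  have hstar : Tendsto (star : V n → V n) (𝓝 0) (𝓝 0) := by
    have := (continuous_star (R := V n)).tendsto 0
    rwa [star_zero] at this
  have hρt : ∀ i, Tendsto (ρ i) (𝓝 0) (𝓝 0) := fun i => (hρ i).tendsto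
  have hΨΨ' : ∀ z, Ψ' (star z) = star (Ψ z) := fun z => funext fun k => mvSum_conjSeries (g k) z
  -- Conjugating the coefficients of `Ψ` moves the conjugation to the outside: `H` is holomorphic,
  -- and `H (star z)` is the conjugated involution `Φ (ρ i (Ψ z))`.
  let H : V n → V n := Φ ∘ (fun w => ρ i (star w)) ∘ Ψ'
  have hHstar : ∀ z, H (star z) = Φ (ρ i (Ψ z)) := by
    intro z
    simp only [H, Function.comp_apply, hΨΨ', star_star]
  have hρ0 : (fun w : V n => ρ i (star w)) 0 = 0 := by simp [(hρ i).map_zero]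
  have hin : AnalyticAt ℂ ((fun w => ρ i (star w)) ∘ Ψ') 0 :=
    (hΨ'0.symm ▸ (hρ i).analyticAt : AnalyticAt ℂ (fun w => ρ i (star w)) (Ψ' 0)).comp hΨ'an.1
  have hin0 : ((fun w => ρ i (star w)) ∘ Ψ') 0 = 0 := by
    rw [Function.comp_apply, hΨ'0]
    exact hρ0
  have hHan : AnalyticAt ℂ H 0 := AnalyticAt.comp (by rwa [hin0]) hin
  have hH0 : H 0 = 0 := by
    change Φ (((fun w => ρ i (star w)) ∘ Ψ') 0) = 0
    rw [hin0, hΦ0]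
  have hHd : fderiv ℂ H 0 = fderiv ℂ (fun w => ρ i (star w)) 0 := by
    have h1 : HasFDerivAt ((fun w => ρ i (star w)) ∘ Ψ')
        ((fderiv ℂ (fun w => ρ i (star w)) 0).comp (ContinuousLinearMap.id ℂ (V n))) 0 :=
      HasFDerivAt.comp 0 (by rw [hΨ'0]; exact (hρ i).hasFDerivAt) hΨ'an.2
    have h2 : HasFDerivAt H ((ContinuousLinearMap.id ℂ (V n)).comp
        ((fderiv ℂ (fun w => ρ i (star w)) 0).comp (ContinuousLinearMap.id ℂ (V n)))) 0 :=
      HasFDerivAt.comp 0 (by rwa [hin0]) h1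
    rw [h2.fderiv]
    rfl
  have hΦρΨ : Tendsto (fun z => Φ (ρ i (Ψ z))) (𝓝 0) (𝓝 0) :=
    hΦt.comp ((hρt i).comp hΨ't)
  have hinter : ∀ j, ∀ᶠ w in 𝓝 (0 : V n), H (star (μ i j) * w) = μ j i * H w := by
    intro j
    -- From `ρ i ∘ (ρ i ∘ ρ j) = ρ j = (ρ j ∘ ρ i) ∘ ρ i`, read in the linearizing coordinates.
    have hz : ∀ᶠ z in 𝓝 (0 : V n), Φ (ρ i (Ψ (μ i j * z))) = μ j i * Φ (ρ i (Ψ z)) := by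
      filter_upwards [hconj i j, ((hρt j).comp hΨ't).eventually (hinvol i),
        ((hρt i).comp hΨ't).eventually hright, hΦρΨ.eventually (hconj j i),
        hΨ't.eventually (hinvol i),
        (((continuous_const_mul (μ j i)).tendsto' (0 : V n) 0 (mul_zero _)).comp
          hΦρΨ).eventually hleft] with z h1 h2 h3 h4 h5 h6
      simp only [Function.comp_apply] at h2 h3 h6
      have h7 : Ψ (μ i j * z) = ρ i (ρ j (Ψ z)) := h1.symm
      have h8 : ρ j (ρ i (Ψ (Φ (ρ i (Ψ z))))) = Ψ (μ j i * Φ (ρ i (Ψ z))) := h4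
      have h9 : Ψ (Φ (ρ i (Ψ z))) = ρ i (Ψ z) := h3
      rw [h9, h5] at h8
      rw [h7, h2, h8]
      exact h6
    filter_upwards [hstar.eventually hz] with w hw
    have h1 : star (μ i j) * w = star (μ i j * star w) := by
      rw [star_mul', star_star]
    rw [h1, hHstar, hw, ← hHstar, star_star]
  have hlin := eventually_eq_fderiv_of_nonresonant hHan hH0 (α := fun j => star (μ i j))
    (β := fun j => μ j i) hinter fun k Q hQ => by
      obtain ⟨j, hj⟩ := hnonres i k Q hQ
      exact ⟨j, fun h => hj (h.trans (eq_inv_of_mul_eq_one_right (hμinv i j k)))⟩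
  filter_upwards [(hstar.comp hΦt).eventually hlin, hright] with z h1 h2
  simp only [Function.comp_apply] at h1
  rw [hHstar, hHd, fderiv_eq_mulVec] at h1
  rw [show Ψ (Φ z) = z from h2] at h1
  exact h1

end Conjugation

end TotallyRealFamily

/-! ### The main theorem -/

open TotallyRealFamily
theorem mainTheorem7 {n m : ℕ} (M : Fin m → Set (V n)) (ρ : Fin m → V n → V n)
    (μ : Fin m → Fin m → V n)
    (hM : ∀ i, IsTotallyRealSubmanifoldGerm (M i))
    (hρ : ∀ i, IsInvolutionOf (M i) (ρ i))
    (hcomm : IsCommutative ρ)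
    (hdiag : ∀ i j, antilinearPart (ρ i) * (antilinearPart (ρ j)).map star =
      Matrix.diagonal (μ i j))
    (hnonres : IsNonResonant μ)
    (hlin : IsFormallyLinearizable (generatedGroup ρ) (fun p : Fin m × Fin m => μ p.1 p.2))
    (hdioph : IsDiophantine (fun p : Fin m × Fin m => μ p.1 p.2)) :
    ∃ Φ : V n → V n, AnalyticAt ℂ Φ 0 ∧ Φ 0 = 0 ∧ fderiv ℂ Φ 0 = ContinuousLinearMap.id ℂ (V n) ∧
      ∀ i, IsTotallyReal (fixedSubspace (antilinearPart (ρ i))) ∧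
        ∀ᶠ z in 𝓝 (0 : V n), z ∈ M i ↔ Φ z ∈ fixedSubspace (antilinearPart (ρ i)) := by
  rcases isEmpty_or_nonempty (Fin m) with hm | hm
  · exact ⟨id, analyticAt_id, rfl, fderiv_id, fun i => (hm.false i).elim⟩
  have hanti : ∀ i, IsAntiholomorphicGerm (ρ i) := fun i => (hρ i).isAntiholomorphicGerm
  have hB : ∀ i, antilinearPart (ρ i) * (antilinearPart (ρ i)).map star = 1 :=
    fun i => (hρ i).antilinearPart_mul
  obtain ⟨hμinv, -⟩ := diagonal_relations hB hdiag
  have hres := hnonres.hasNoResonance hB hdiag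
  obtain ⟨A, hA0, hA1, -, hA⟩ := hlin
  choose T hT hAT using fun p : Fin m × Fin m => hA _ (generatedGroup.gen p.1 p.2)
  have hAT' : ∀ p k, (A k).subst (T p) = μ p.1 p.2 k • A k := by
    intro p k
    rw [hAT, linearPart_comp (hanti _) (hanti _), hdiag, Finset.sum_eq_single k]
    · rw [Matrix.diagonal_apply_eq]
    · intro b _ hb
      rw [Matrix.diagonal_apply_ne _ hb.symm, zero_smul]
    · simp
  obtain ⟨g, s, hg, hs, hgs, hconj⟩ := exists_convergent_linearization hres
    (fun p k => left_ne_zero_of_mul_eq_one (hμinv p.1 p.2 k)) hdioph hT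
    (fun p => by rw [Function.comp_apply, (hρ _).map_zero, (hρ _).map_zero]) ⟨hA0, hA1⟩ hAT'
  have hΨ0 : (fun k => mvSum (g k) (0 : V n)) = 0 := by
    funext k
    rw [mvSum_zero, hg.constantCoeff_eq_zero, Pi.zero_apply]
  obtain ⟨hΨ, hΨ'⟩ := hg.hasFDerivAt hs hgs
  obtain ⟨Φ, hΦ, hΦ0, hΦ', hleft, hright⟩ := exists_analytic_inverse hΨ hΨ0 hΨ'
  refine ⟨Φ, hΦ, hΦ0, hΦ'.fderiv, fun i => ⟨isTotallyReal_fixedSubspace (hB i), ?_⟩⟩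
  filter_upwards [eventually_conj_eq_mulVec hanti (fun i => (hρ i).involutive) hμinv hnonres hg hs
    hgs (fun i j => hconj (i, j)) hΦ hΦ0 hΦ' hleft hright i, (hρ i).fixed, hright,
    (hanti i).tendsto.eventually hright] with z h1 h2 h3 h4
  change _ ↔ (antilinearPart (ρ i)).mulVec (star (Φ z)) = Φ z
  rw [h2, ← h1]
  -- For the converse, `Φ (ρ i z) = Φ z` gives `ρ i z = z` after applying the sum of `g`, a local
  -- left inverse of `Φ` near both points.
  refine ⟨fun h => by rw [h], fun h => ?_⟩
  rw [← h4, h, h3]
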